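/- Let $V:\mathbb R\to\mathbb R$ be locally integrable, $\mathcal A=-\frac{d^2}{dx^2}+V$, let $a_-<a_+$ be real numbers, and put $I_-=(-\infty,a_-]$, $I_+=[a_+,\infty)$. For an interval $J$ (here $J=\mathbb R, I_-, I_+$) let $\mathcal A$ act in $L^2(J)$ on its maximal domain, i.e. on all $f\in L^2(J)$ such that $f,f'$ are locally absolutely continuous on $J$ and $-f''+Vf\in L^2(J)$. Write $A_\pm^*$ for the resulting operator in $L^2(I_\pm)$ and $H$ for the one in $L^2(\mathbb R)$. Assume: * (H1) $\mathcal A$ is in the limit point case at $\pm\infty$, i.e. $\dim\ker(A_\pm^*-i)=\dim\ker(A_\pm^*+i)=1$ for both choices of the sign $\pm$ (then $H$ is self-adjoint); * (H2) the spectrum of $H$ is discrete, i.e. it consists of isolated points which are eigenvalues of finite multiplicity. For $\lambda\in\mathbb C\setminus\mathbb R$ let $c_\pm(\lambda,\cdot)$, $s_\pm(\lambda,\cdot)$ be the solutions of $-f''+Vf=\lambda f$ on $I_\pm$ with $c_\pm(\lambda,a_\pm)=s_\pm'(\lambda,a_\pm)=1$, $c_\pm'(\lambda,a_\pm)=s_\pm(\lambda,a_\pm)=0$,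 and let the Weyl–Titchmarsh coefficient $m_\pm(\lambda)$ be the number with $c_\pm(\lambda,\cdot)\pm m_\pm(\lambda)s_\pm(\lambda,\cdot)\in L^2(I_\pm)$. Then $m_-$ and $m_+$ extend to meromorphic functions on $\mathbb C$ (denoted by the same letters), and the set of all $E\in\mathbb R$ for which there is a nontrivial $\varphi\in L^2(a_-,a_+)$, with $\varphi,\varphi'$ absolutely continuous on $[a_-,a_+]$, such that $$-\varphi''+V\varphi=E\varphi\ \text{ on }(a_-,a_+),\qquad \varphi'(a_-)+m_-(E)\varphi(a_-)=0,\qquad \varphi'(a_+)-m_+(E)\varphi(a_+)=0$$ (where, if $E$ is a pole of $m_-$, resp. of $m_+$, the corresponding boundary condition is understood as $\varphi(a_-)=0$, resp. $\varphi(a_+)=0$) coincides with the set $\sigma_p(H)\subset\mathbb C$ of all eigenvalues of $H$. -/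

import Mathlib

open MeasureTheory Set Filter Topology

noncomputable section

namespace Schrodinger

/-- `f` is locally absolutely continuous on the interval `I`, i.e. absolutely continuous on every
compact subinterval of `I`. -/
def LocAC (I : Set ℝ) (f : ℝ → ℂ) : Prop :=
  ∀ x ∈ I, ∀ y ∈ I, AbsolutelyContinuousOnInterval f x y

/-- `u` and its derivative `u'` are locally absolutely continuous on the interval `I`, and
`-u'' + V u = g` almost everywhere on `I`. Derivatives are relative to `I`, hence one-sided at an
endpoint which belongs to `I`. Nothing is said about the values of `u`, `u'`, `g` outside `I`. -/
structure Solves (V : ℝ → ℝ) (I : Set ℝ) (u u' g : ℝ → ℂ) : Prop where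
  ac : LocAC I u
  deriv : ∀ x ∈ I, HasDerivWithinAt u (u' x) I x
  ac' : LocAC I u'
  eqn : ∀ᵐ x ∂(volume.restrict I), ∃ w : ℂ, HasDerivWithinAt u' w I x ∧ -w + V x * u x = g x

/-- The complex Hilbert space `L²(I)`. -/
abbrev L2 (I : Set ℝ) : Type := Lp ℂ 2 ((volume : Measure ℝ).restrict I)

theorem LocAC.zero (I : Set ℝ) : LocAC I (fun _ => 0) := fun x _ y _ => by
  simpa [AbsolutelyContinuousOnInterval] using tendsto_const_nhds

theorem Solves.zero (V : ℝ → ℝ) (I : Set ℝ) :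
    Solves V I (fun _ => 0) (fun _ => 0) (fun _ => 0) where
  ac := LocAC.zero I
  deriv := fun _ _ => hasDerivWithinAt_const _ _ _
  ac' := LocAC.zero I
  eqn := Eventually.of_forall fun _ => ⟨0, hasDerivWithinAt_const _ _ _, by simp⟩

theorem Solves.add {V : ℝ → ℝ} {I : Set ℝ} {u u' g v v' h : ℝ → ℂ}
    (hu : Solves V I u u' g) (hv : Solves V I v v' h) :
    Solves V I (fun x => u x + v x) (fun x => u' x + v' x) (fun x => g x + h x) where
  ac := fun x hx y hy => (hu.ac x hx y hy).add (hv.ac x hx y hy)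
  deriv := fun x hx => (hu.deriv x hx).add (hv.deriv x hx)
  ac' := fun x hx y hy => (hu.ac' x hx y hy).add (hv.ac' x hx y hy)
  eqn := by
    filter_upwards [hu.eqn, hv.eqn] with x ⟨w, hw, e⟩ ⟨z, hz, e'⟩
    exact ⟨w + z, hw.add hz, by rw [← e, ← e']; ring⟩

theorem Solves.const_mul {V : ℝ → ℝ} {I : Set ℝ} {u u' g : ℝ → ℂ} (c : ℂ)
    (hu : Solves V I u u' g) :
    Solves V I (fun x => c * u x) (fun x => c * u' x) (fun x => c * g x) where
  ac := fun x hx y hy => (hu.ac x hx y hy).const_smul c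
  deriv := fun x hx => (hu.deriv x hx).const_mul c
  ac' := fun x hx y hy => (hu.ac' x hx y hy).const_smul c
  eqn := by
    filter_upwards [hu.eqn] with x ⟨w, hw, e⟩
    exact ⟨c * w, hw.const_mul c, by rw [← e]; ring⟩

theorem Solves.congr_rhs {V : ℝ → ℝ} {I : Set ℝ} {u u' g h : ℝ → ℂ}
    (hu : Solves V I u u' g) (hgh : g =ᵐ[volume.restrict I] h) : Solves V I u u' h where
  ac := hu.ac
  deriv := hu.deriv
  ac' := hu.ac'
  eqn := by
    filter_upwards [hu.eqn, hgh] with x ⟨w, hw, e⟩ e'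
    exact ⟨w, hw, e.trans e'⟩

/-- The graph of the maximal operator of `-d²/dx² + V` in `L²(I)`: the pairs `(f, g)` in
`L²(I) × L²(I)` such that (the continuous representative of) `f` and its derivative are locally
absolutely continuous on `I` and `-f'' + V f = g`. -/
def maxGraph (V : ℝ → ℝ) (I : Set ℝ) : Submodule ℂ (L2 I × L2 I) where
  carrier := {p | ∃ u u' : ℝ → ℂ, p.1 =ᵐ[volume.restrict I] u ∧ Solves V I u u' p.2}
  zero_mem' := ⟨fun _ => 0, fun _ => 0, Lp.coeFn_zero _ _ _,
    (Solves.zero V I).congr_rhs (Lp.coeFn_zero _ _ _).symm⟩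
  add_mem' := by
    rintro ⟨f, g⟩ ⟨f₁, g₁⟩ ⟨u, u', hf, hu⟩ ⟨v, v', hf₁, hv⟩
    refine ⟨_, _, ?_, (hu.add hv).congr_rhs (Lp.coeFn_add g g₁).symm⟩
    filter_upwards [Lp.coeFn_add f f₁, hf, hf₁] with x h1 h2 h3
    simp only [Prod.mk_add_mk] at *
    rw [h1, Pi.add_apply, h2, h3]
  smul_mem' := by
    rintro c ⟨f, g⟩ ⟨u, u', hf, hu⟩
    refine ⟨_, _, ?_, (hu.const_mul c).congr_rhs (Lp.coeFn_smul c g).symm⟩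
    filter_upwards [Lp.coeFn_smul c f, hf] with x h1 h2
    simp only [Prod.smul_mk] at *
    rw [h1, Pi.smul_apply, h2, smul_eq_mul]

/-- The maximal operator generated by `-d²/dx² + V` in `L²(I)`. -/
def maxOperator (V : ℝ → ℝ) (I : Set ℝ) : L2 I →ₗ.[ℂ] L2 I :=
  (maxGraph V I).toLinearPMap

/-- The maximal operator is well defined: `f = 0` in `L²(I)` forces `-f'' + V f = 0`. -/
theorem maxGraph_single_valued (V : ℝ → ℝ) {I : Set ℝ} (hI : I.OrdConnected)
    (p : L2 I × L2 I) (hp : p ∈ maxGraph V I) (h0 : p.1 = 0) :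
    p.2 = 0 := by
  obtain ⟨u, u', hf, hu⟩ := hp
  have hconv : Convex ℝ I := hI.convex
  rw [h0] at hf
  have hu0 : EqOn u (fun _ => 0) (interior I) :=
    Measure.eqOn_open_of_ae_eq (ae_restrict_of_ae_restrict_of_subset interior_subset
        (hf.symm.trans (Lp.coeFn_zero ℂ 2 (volume.restrict I)))) isOpen_interior
      (fun x hx => ((hu.deriv x (interior_subset hx)).continuousWithinAt).mono interior_subset)
      continuousOn_const
  have hd : ∀ x ∈ interior I, u' x = 0 := fun x hx => by
    have h1 := (hu.deriv x (interior_subset hx)).hasDerivAt (mem_interior_iff_mem_nhds.1 hx)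
    have h2 : HasDerivAt u 0 x :=
      (hasDerivAt_const x (0 : ℂ)).congr_of_eventuallyEq
        (by filter_upwards [isOpen_interior.mem_nhds hx] with y hy using hu0 hy)
    exact h1.unique h2
  have hint : ∀ᵐ x ∂((volume : Measure ℝ).restrict I), x ∈ interior I := by
    have hfr : volume (frontier I) = 0 := hconv.addHaar_frontier volume
    have hmI : ∀ᵐ x ∂((volume : Measure ℝ).restrict I), x ∈ I :=
      ae_restrict_mem hI.measurableSet
    have hnf : ∀ᵐ x ∂((volume : Measure ℝ).restrict I), x ∉ frontier I :=
      ae_restrict_of_ae (measure_eq_zero_iff_ae_notMem.1 hfr)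
    filter_upwards [hmI, hnf] with x hx hx'
    by_contra hni
    exact hx' ⟨subset_closure hx, hni⟩
  refine Lp.ext ?_
  filter_upwards [hu.eqn, hint, Lp.coeFn_zero ℂ 2 ((volume : Measure ℝ).restrict I)]
    with x ⟨w, hw, e⟩ hx hz
  have h1 : HasDerivAt u' w x := hw.hasDerivAt (mem_interior_iff_mem_nhds.1 hx)
  have h2 : HasDerivAt u' 0 x :=
    (hasDerivAt_const x (0 : ℂ)).congr_of_eventuallyEq
      (by filter_upwards [isOpen_interior.mem_nhds hx] with y hy using hd y hy)
  rw [hz, ← e, h1.unique h2, hu0 hx]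
  simp

theorem maxOperator_graph (V : ℝ → ℝ) {I : Set ℝ} (hI : I.OrdConnected) :
    (maxOperator V I).graph = maxGraph V I :=
  Submodule.toLinearPMap_graph_eq _ (maxGraph_single_valued V hI)

section Operators

/-- The eigenspace `ker (A - lam)` of an unbounded operator `A`. -/
def eigenspace {E : Type*} [NormedAddCommGroup E] [NormedSpace ℂ E] (A : E →ₗ.[ℂ] E) (lam : ℂ) :
    Submodule ℂ E where
  carrier := {f | ∃ h : f ∈ A.domain, A ⟨f, h⟩ = lam • f}
  zero_mem' := ⟨A.domain.zero_mem, by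
    rw [smul_zero]
    exact A.map_zero⟩
  add_mem' := by
    rintro f g ⟨hf, ef⟩ ⟨hg, eg⟩
    refine ⟨A.domain.add_mem hf hg, ?_⟩
    have := A.map_add ⟨f, hf⟩ ⟨g, hg⟩
    rw [ef, eg, ← smul_add] at this
    exact this
  smul_mem' := by
    rintro c f ⟨hf, ef⟩
    refine ⟨A.domain.smul_mem c hf, ?_⟩
    have := A.map_smul c ⟨f, hf⟩
    rw [ef, smul_comm] at this
    exact this

/-- The point spectrum: the set of all eigenvalues. -/
def pointSpectrum {E : Type*} [NormedAddCommGroup E] [NormedSpace ℂ E] (A : E →ₗ.[ℂ] E) : Set ℂ :=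
  {lam | eigenspace A lam ≠ ⊥}

/-- The resolvent set: those `lam` for which `A - lam` has an everywhere defined bounded inverse. -/
def resolventSet {E : Type*} [NormedAddCommGroup E] [NormedSpace ℂ E] (A : E →ₗ.[ℂ] E) : Set ℂ :=
  {lam | ∃ R : E →L[ℂ] E, (∀ g, ∃ h : R g ∈ A.domain, A ⟨R g, h⟩ - lam • R g = g) ∧
    ∀ f : A.domain, R (A f - lam • (f : E)) = f}

/-- The spectrum of an unbounded operator. -/
def spectrum {E : Type*} [NormedAddCommGroup E] [NormedSpace ℂ E] (A : E →ₗ.[ℂ] E) : Set ℂ :=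
  (resolventSet A)ᶜ

/-- The spectrum is discrete: it consists of isolated points which are eigenvalues of finite
multiplicity. -/
def HasDiscreteSpectrum {E : Type*} [NormedAddCommGroup E] [NormedSpace ℂ E] (A : E →ₗ.[ℂ] E) :
    Prop :=
  ∀ lam ∈ spectrum A, ¬ AccPt lam (𝓟 (spectrum A)) ∧ lam ∈ pointSpectrum A ∧
    FiniteDimensional ℂ (eigenspace A lam)

end Operators

/-- The limit point case at the infinite endpoint of the half-line `I`: both defect numbers,
`dim ker (A* - i)` and `dim ker (A* + i)` with `A*` the maximal operator in `L²(I)`, equal `1`. -/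
def LimitPoint (V : ℝ → ℝ) (I : Set ℝ) : Prop :=
  Module.finrank ℂ (eigenspace (maxOperator V I) Complex.I) = 1 ∧
    Module.finrank ℂ (eigenspace (maxOperator V I) (-Complex.I)) = 1

/-- `m` is a Weyl-Titchmarsh coefficient of `-d²/dx² + V` on the half-line `I` with finite
endpoint `a`: for each non-real `lam`, if `c`, `s` are the solutions of `-f'' + V f = lam f` on `I`
with `c(a) = s'(a) = 1`, `c'(a) = s(a) = 0`, then `c + ε m(lam) s` lies in `L²(I)`. The sign `ε`
is `1` for `I = [a, ∞)` and `-1` for `I = (-∞, a]`. -/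
def IsWeylCoefficient (V : ℝ → ℝ) (I : Set ℝ) (a : ℝ) (ε : ℂ) (m : ℂ → ℂ) : Prop :=
  ∀ lam : ℂ, lam.im ≠ 0 → ∃ c c' s s' : ℝ → ℂ,
    Solves V I c c' (fun x => lam * c x) ∧ c a = 1 ∧ c' a = 0 ∧
    Solves V I s s' (fun x => lam * s x) ∧ s a = 0 ∧ s' a = 1 ∧
    MemLp (fun x => c x + ε * m lam * s x) 2 (volume.restrict I)

/-- `m` is the Weyl-Titchmarsh coefficient, extended to a meromorphic function on `ℂ`. The normal
form fixes the values at real points: `m` is continuous wherever it has no pole. -/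
structure IsMeromorphicWeylCoefficient (V : ℝ → ℝ) (I : Set ℝ) (a : ℝ) (ε : ℂ) (m : ℂ → ℂ) :
    Prop where
  meromorphic : MeromorphicNFOn m univ
  weyl : IsWeylCoefficient V I a ε m

/-- `m` has a pole at `z`. -/
def HasPole (m : ℂ → ℂ) (z : ℂ) : Prop := meromorphicOrderAt m z < 0

/-- `E` is an eigenvalue of the problem `-φ'' + V φ = E φ` on `I = [a, b]` with the
energy dependent boundary conditions `φ'(a) + τ₁(E) φ(a) = 0` and `φ'(b) - τ₂(E) φ(b) = 0`, which
at a pole of `τ₁`, resp. `τ₂`, are replaced by `φ(a) = 0`, resp. `φ(b) = 0`. -/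
def IsEigenvalue (V : ℝ → ℝ) (a b : ℝ) (τ₁ τ₂ : ℂ → ℂ) (E : ℝ) : Prop :=
  ∃ φ φ' : ℝ → ℂ, MemLp φ 2 (volume.restrict (Icc a b)) ∧ (∃ x ∈ Icc a b, φ x ≠ 0) ∧
    Solves V (Icc a b) φ φ' (fun x => E * φ x) ∧
    (HasPole τ₁ E → φ a = 0) ∧ (¬ HasPole τ₁ E → φ' a + τ₁ E * φ a = 0) ∧
    (HasPole τ₂ E → φ b = 0) ∧ (¬ HasPole τ₂ E → φ' b - τ₂ E * φ b = 0)

end Schrodinger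

end

noncomputable section

namespace Schrodinger

/-! ### Absolute continuity and integral equations with locally integrable coefficients -/

section


/-! The boundary conditions at a real energy `E` say exactly that a solution on the interval
continues to both sides as a square integrable solution. Two facts on each half-line carry this:
every square integrable solution at `E` obeys the boundary condition built from the continued
coefficient `m`, and a nontrivial such solution exists. Then an eigenfunction of `H` restricts to a
solution of the interval problem. Conversely, the extension of an interval solution has zero
Wronskian at each endpoint with the square integrable solution there, hence is a multiple of it.

The first fact is `GreenAt.boundary_condition`. Comparing `u` at energy `E` with the Weyl solution
`φ` at `E + iη`, Green's identity, Cauchy-Schwarz and `η ‖φ‖² = Im m(E + iη)` give `|u' + σ m u|² ≤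
‖u‖² η |m(E + iη)|` at the endpoint. Let `η → 0`, after dividing by `|m|²` if `E` is a pole. Green's
identity must have no term at infinity; `IsHalfLine.greenAt` derives this from the defect numbers by
von Neumann's decomposition.

Existence and meromorphy come from the resolvent of `H`. By `exists_split`, Cauchy data at a point
are split into data of square integrable solutions on the two sides, and the pieces are expressed by
matrix elements of the resolvent; `m` is a quotient of such functions. On the spectrum, which
consists of eigenvalues, an eigenfunction supplies the solution. Green's identity on both sides
makes `H` symmetric; with discreteness this already puts nonreal numbers into the resolvent set. The
resolvents are then normal, so their norm is controlled by the distance to the spectrum, and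
isolated singularities of matrix elements are at worst poles
(`IsSymm.meromorphicAt_inner_resolventAt`). -/

theorem absolutelyContinuousOnInterval_of_dist_le {X Y : Type*} [PseudoMetricSpace X]
    [PseudoMetricSpace Y] {f : ℝ → X} {g : ℝ → Y} {a b K : ℝ}
    (hg : AbsolutelyContinuousOnInterval g a b)
    (h : ∀ x ∈ uIcc a b, ∀ y ∈ uIcc a b, dist (f x) (f y) ≤ K * dist (g x) (g y)) :
    AbsolutelyContinuousOnInterval f a b := by
  have h0 : Tendsto (fun E : ℕ × (ℕ → ℝ × ℝ) =>
      K * ∑ i ∈ Finset.range E.1, dist (g (E.2 i).1) (g (E.2 i).2))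
      (AbsolutelyContinuousOnInterval.totalLengthFilter ⊓
        𝓟 (AbsolutelyContinuousOnInterval.disjWithin a b)) (𝓝 0) := by
    simpa using Tendsto.const_mul K hg
  refine squeeze_zero' (Eventually.of_forall fun E => Finset.sum_nonneg fun i _ => dist_nonneg)
    ?_ h0
  rw [eventually_inf_principal]
  refine Eventually.of_forall fun E hE => ?_
  rw [Finset.mul_sum]
  exact Finset.sum_le_sum fun i hi => h _ (hE.1 i hi).1 _ (hE.1 i hi).2

theorem _root_.MeasureTheory.LocallyIntegrable.intervalIntegrable' {E : Type*}
    [NormedAddCommGroup E] {f : ℝ → E} (hf : LocallyIntegrable f volume) (a b : ℝ) :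
    IntervalIntegrable f volume a b :=
  intervalIntegrable_iff.mpr <|
    (hf.integrableOn_isCompact isCompact_uIcc).mono_set uIoc_subset_uIcc

theorem absolutelyContinuousOnInterval_integral {E : Type*} [NormedAddCommGroup E]
    [NormedSpace ℝ E] {f : ℝ → E} (hf : LocallyIntegrable f volume) (c x y : ℝ) :
    AbsolutelyContinuousOnInterval (fun x => ∫ t in c..x, f t) x y := by
  refine absolutelyContinuousOnInterval_of_dist_le (K := 1)
    (((hf.intervalIntegrable' x y).norm).absolutelyContinuousOnInterval_intervalIntegral
      (c := x) left_mem_uIcc) fun s _ t _ => ?_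
  have hn := fun p q => (hf.intervalIntegrable' p q)
  rw [dist_eq_norm, dist_eq_norm, intervalIntegral.integral_interval_sub_left (hn _ _) (hn _ _),
    intervalIntegral.integral_interval_sub_left (hn _ _).norm (hn _ _).norm, one_mul]
  exact intervalIntegral.norm_integral_le_abs_integral_norm

/-- The fundamental theorem of calculus for absolutely continuous functions. -/
theorem _root_.AbsolutelyContinuousOnInterval.integral_eq_sub {E : Type*} [NormedAddCommGroup E]
    [NormedSpace ℝ E] [CompleteSpace E] {f f' : ℝ → E} {a b : ℝ}
    (hf : AbsolutelyContinuousOnInterval f a b) (hf' : IntervalIntegrable f' volume a b)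
    (h : ∀ᵐ x, x ∈ uIcc a b → HasDerivAt f (f' x) x) : ∫ x in a..b, f' x = f b - f a := by
  have key : AbsolutelyContinuousOnInterval (fun x => ∫ t in a..x, f' t) a b := by
    refine absolutelyContinuousOnInterval_of_dist_le (K := 1)
      (hf'.norm.absolutelyContinuousOnInterval_intervalIntegral (c := a) left_mem_uIcc)
      fun s hs t ht => ?_
    have hn : ∀ p ∈ uIcc a b, ∀ q ∈ uIcc a b, IntervalIntegrable f' volume p q :=
      fun p hp q hq => hf'.mono_set (uIcc_subset_uIcc hp hq)
    have ha : a ∈ uIcc a b := left_mem_uIcc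
    rw [dist_eq_norm, dist_eq_norm,
      intervalIntegral.integral_interval_sub_left (hn _ ha _ hs) (hn _ ha _ ht),
      intervalIntegral.integral_interval_sub_left (hn _ ha _ hs).norm (hn _ ha _ ht).norm, one_mul]
    exact intervalIntegral.norm_integral_le_abs_integral_norm
  obtain ⟨C, hC⟩ := (hf.sub key).const_of_ae_hasDerivAt_zero (by
    filter_upwards [h, hf'.ae_hasDerivAt_integral] with x h1 h2 hx
    simpa using (h1 hx).sub (h2 hx a left_mem_uIcc))
  have h1 := hC a left_mem_uIcc
  have h2 := hC b right_mem_uIcc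
  simp only [Pi.sub_apply, intervalIntegral.integral_same, sub_zero] at h1 h2
  rw [h1, ← h2]
  abel

theorem _root_.AbsolutelyContinuousOnInterval.real_exp {g : ℝ → ℝ} {a b : ℝ}
    (hg : AbsolutelyContinuousOnInterval g a b) :
    AbsolutelyContinuousOnInterval (fun x => Real.exp (g x)) a b := by
  obtain ⟨C, hC⟩ := hg.exists_bound
  obtain ⟨K, hK⟩ := (Real.contDiff_exp (n := 1)).contDiffOn.exists_lipschitzOnWith (by decide)
    (convex_Icc (-C) C) isCompact_Icc
  exact absolutelyContinuousOnInterval_of_dist_le (K := K) hg fun x hx y hy =>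
    hK.dist_le_mul _ (abs_le.1 (hC x hx)) _ (abs_le.1 (hC y hy))

/-- The exponential of `τ ∫ a` is absolutely continuous with the integrand (times `τ`) as its
derivative almost everywhere; continuity of `a` is not available, so the absolutely continuous form
of the fundamental theorem is needed. -/
theorem integral_mul_exp_integral {a : ℝ → ℝ} (ha : LocallyIntegrable a volume) (τ x₀ x : ℝ) :
    τ * ∫ t in x₀..x, a t * Real.exp (τ * ∫ s in x₀..t, a s) =
      Real.exp (τ * ∫ s in x₀..x, a s) - 1 := by
  have hac : AbsolutelyContinuousOnInterval (fun t => Real.exp (τ * ∫ s in x₀..t, a s)) x₀ x :=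
    ((absolutelyContinuousOnInterval_integral ha x₀ x₀ x).const_mul τ).real_exp
  have hcont : Continuous fun t => Real.exp (τ * ∫ s in x₀..t, a s) :=
    Real.continuous_exp.comp (continuous_const.mul
      (intervalIntegral.continuous_primitive (fun p q => ha.intervalIntegrable' p q) x₀))
  have hi : IntervalIntegrable (fun t => τ * (a t * Real.exp (τ * ∫ s in x₀..t, a s)))
      volume x₀ x :=
    ((ha.intervalIntegrable' x₀ x).mul_continuousOn hcont.continuousOn).const_mul τ
  rw [← intervalIntegral.integral_const_mul, hac.integral_eq_sub hi]
  · simp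
  · filter_upwards [LocallyIntegrable.ae_hasDerivAt_integral ha] with t ht _
    exact ((ht x₀).const_mul τ).exp.congr_deriv (by ring)

/-- The weight `exp (2 |∫ a|)` makes Volterra operators with kernel bounded by `a` contractive. -/
theorem abs_integral_mul_weight_le {a : ℝ → ℝ} (ha : LocallyIntegrable a volume)
    (ha0 : ∀ t, 0 ≤ a t) (x₀ x : ℝ) :
    |∫ t in x₀..x, a t * Real.exp (2 * |∫ s in x₀..t, a s|)| ≤
      Real.exp (2 * |∫ s in x₀..x, a s|) / 2 := by
  rcases le_total x₀ x with h | h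
  · have e : ∀ t, x₀ ≤ t → |∫ s in x₀..t, a s| = ∫ s in x₀..t, a s := fun t ht =>
      abs_of_nonneg (intervalIntegral.integral_nonneg ht fun s _ => ha0 s)
    have e1 : ∫ t in x₀..x, a t * Real.exp (2 * |∫ s in x₀..t, a s|) =
        ∫ t in x₀..x, a t * Real.exp (2 * ∫ s in x₀..t, a s) :=
      intervalIntegral.integral_congr fun t ht => by
        rw [uIcc_of_le h] at ht
        simp only [e t ht.1]
    have e2 := integral_mul_exp_integral ha 2 x₀ x
    have e3 : 1 ≤ Real.exp (2 * ∫ s in x₀..x, a s) := by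
      rw [← e x h]; exact Real.one_le_exp (by positivity)
    rw [e1, e x h, abs_le]
    constructor <;> linarith
  · have e : ∀ t, t ≤ x₀ → |∫ s in x₀..t, a s| = -∫ s in x₀..t, a s := fun t ht =>
      abs_of_nonpos (by
        rw [intervalIntegral.integral_symm, neg_nonpos]
        exact intervalIntegral.integral_nonneg ht fun s _ => ha0 s)
    have e1 : ∫ t in x₀..x, a t * Real.exp (2 * |∫ s in x₀..t, a s|) =
        ∫ t in x₀..x, a t * Real.exp (-2 * ∫ s in x₀..t, a s) :=
      intervalIntegral.integral_congr fun t ht => by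
        rw [uIcc_of_ge h] at ht
        simp only [e t ht.2]
        congr 2
        ring
    have e2 := integral_mul_exp_integral ha (-2) x₀ x
    have e3 : 1 ≤ Real.exp (-2 * ∫ s in x₀..x, a s) := by
      have : -2 * ∫ s in x₀..x, a s = 2 * |∫ s in x₀..x, a s| := by rw [e x h]; ring
      rw [this]; exact Real.one_le_exp (by positivity)
    have e4 : 2 * |∫ s in x₀..x, a s| = -2 * ∫ s in x₀..x, a s := by rw [e x h]; ring
    rw [e1, e4, abs_le]
    constructor <;> linarith

/-- Global existence for integral equations with a Lipschitz constant which is merely locally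
integrable in time. -/
theorem exists_continuous_eq_integral {E : Type*} [NormedAddCommGroup E] [NormedSpace ℝ E]
    [CompleteSpace E] {a : ℝ → ℝ} (ha : LocallyIntegrable a volume) (ha0 : ∀ t, 0 ≤ a t)
    {G : ℝ → E → E} (hG : ∀ y : ℝ → E, Continuous y → LocallyIntegrable (fun t => G t (y t)) volume)
    (hlip : ∀ t y z, ‖G t y - G t z‖ ≤ a t * ‖y - z‖) (h0 : ∀ t, ‖G t 0‖ ≤ a t) (x₀ : ℝ) (y₀ : E) :
    ∃ y : ℝ → E, Continuous y ∧ ∀ x, y x = y₀ + ∫ t in x₀..x, G t (y t) := by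
  -- Bielecki's weight: the exponent `2` yields the contraction constant `1 / 2` on the whole line
  -- at once, without continuation from short intervals.
  set w : ℝ → ℝ := fun x => Real.exp (2 * |∫ s in x₀..x, a s|) with hw
  have wpos : ∀ x, 0 < w x := fun x => Real.exp_pos _
  have wone : ∀ x, 1 ≤ w x := fun x => Real.one_le_exp (by positivity)
  have wc : Continuous w := Real.continuous_exp.comp (continuous_const.mul
      (intervalIntegral.continuous_primitive (fun p q => ha.intervalIntegrable' p q) x₀).abs)
  have hwle : ∀ x, |∫ t in x₀..x, a t * w t| ≤ w x / 2 := abs_integral_mul_weight_le ha ha0 x₀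
  have haw : ∀ x, IntervalIntegrable (fun t => a t * w t) volume x₀ x := fun x =>
    (ha.intervalIntegrable' x₀ x).mul_continuousOn wc.continuousOn
  have bound : ∀ (F : ℝ → E) (C : ℝ), 0 ≤ C → (∀ t, ‖F t‖ ≤ C * (a t * w t)) → ∀ x,
      ‖(w x)⁻¹ • ∫ t in x₀..x, F t‖ ≤ C / 2 := by
    intro F C hC hF x
    have h1 : ‖∫ t in x₀..x, F t‖ ≤ |∫ t in x₀..x, C * (a t * w t)| :=
      intervalIntegral.norm_integral_le_abs_of_norm_le (Eventually.of_forall hF)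
        ((haw x).const_mul C)
    rw [intervalIntegral.integral_const_mul, abs_mul, abs_of_nonneg hC] at h1
    rw [norm_smul, norm_inv, Real.norm_of_nonneg (wpos x).le, inv_mul_le_iff₀ (wpos x)]
    calc _ ≤ C * |∫ t in x₀..x, a t * w t| := h1
      _ ≤ C * (w x / 2) := by gcongr; exact hwle x
      _ = w x * (C / 2) := by ring
  have hc : ∀ z : BoundedContinuousFunction ℝ E, Continuous fun t => w t • z t := fun z =>
    wc.smul z.continuous
  have hgz : ∀ (z : BoundedContinuousFunction ℝ E) t, ‖G t (w t • z t)‖ ≤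
      (‖z‖ + 1) * (a t * w t) := by
    intro z t
    have h1 := hlip t (w t • z t) 0
    have h2 : ‖w t • z t‖ ≤ w t * ‖z‖ := by
      rw [norm_smul, Real.norm_of_nonneg (wpos t).le]
      exact mul_le_mul_of_nonneg_left (z.norm_coe_le_norm t) (wpos t).le
    rw [sub_zero] at h1
    calc _ ≤ ‖G t (w t • z t) - G t 0‖ + ‖G t 0‖ := norm_le_norm_sub_add _ _
      _ ≤ a t * (w t * ‖z‖) + a t * w t := by
          refine add_le_add (h1.trans (mul_le_mul_of_nonneg_left h2 (ha0 t))) ((h0 t).trans ?_)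
          exact le_mul_of_one_le_right (ha0 t) (wone t)
      _ = _ := by ring
  -- The Picard map in the unknown `z = y / w`, which stays bounded although `y` need not.
  let T : BoundedContinuousFunction ℝ E → BoundedContinuousFunction ℝ E := fun z =>
    BoundedContinuousFunction.ofNormedAddCommGroup
      (fun x => (w x)⁻¹ • y₀ + (w x)⁻¹ • ∫ t in x₀..x, G t (w t • z t))
      ((((wc.inv₀ fun x => (wpos x).ne').smul continuous_const).add
        ((wc.inv₀ fun x => (wpos x).ne').smul (intervalIntegral.continuous_primitive
          (fun p q => (hG _ (hc z)).intervalIntegrable' p q) x₀))))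
      (‖y₀‖ + (‖z‖ + 1) / 2) (fun x => by
        refine (norm_add_le _ _).trans (add_le_add ?_ (bound _ _ (by positivity) (hgz z) x))
        rw [norm_smul, norm_inv, Real.norm_of_nonneg (wpos x).le, inv_mul_le_iff₀ (wpos x)]
        exact le_mul_of_one_le_left (norm_nonneg _) (wone x))
  have hT : ContractingWith (1 / 2) T := by
    refine ⟨by norm_num, LipschitzWith.of_dist_le_mul fun z z' => ?_⟩
    rw [BoundedContinuousFunction.dist_le (by positivity)]
    intro x
    have e : T z x - T z' x =
        (w x)⁻¹ • ∫ t in x₀..x, (G t (w t • z t) - G t (w t • z' t)) := by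
      rw [intervalIntegral.integral_sub ((hG _ (hc z)).intervalIntegrable' _ _)
        ((hG _ (hc z')).intervalIntegrable' _ _), smul_sub]
      simp only [T, BoundedContinuousFunction.coe_ofNormedAddCommGroup]
      abel
    rw [dist_eq_norm, e]
    refine (bound _ (dist z z') dist_nonneg (fun t => ?_) x).trans_eq (by
      push_cast; ring)
    refine (hlip _ _ _).trans ?_
    rw [← smul_sub, norm_smul, Real.norm_of_nonneg (wpos t).le, ← dist_eq_norm]
    calc _ ≤ a t * (w t * dist z z') :=
          mul_le_mul_of_nonneg_left (mul_le_mul_of_nonneg_left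
            (BoundedContinuousFunction.dist_coe_le_dist t) (wpos t).le) (ha0 t)
      _ = _ := by ring
  set z := hT.fixedPoint
  have hz : T z = z := hT.fixedPoint_isFixedPt
  refine ⟨fun t => w t • z t, hc z, fun x => ?_⟩
  have : z x = (w x)⁻¹ • y₀ + (w x)⁻¹ • ∫ t in x₀..x, G t (w t • z t) :=
    (congrArg (fun f : BoundedContinuousFunction ℝ E => f x) hz).symm
  simp only
  nth_rewrite 1 [this]
  rw [← smul_add, smul_inv_smul₀ (wpos x).ne']

end

/-! ### Solutions of the equation: existence, Lagrange identity, uniqueness -/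

section


theorem exists_solves {V : ℝ → ℝ} (hV : LocallyIntegrable V volume) (lam : ℂ) {F : ℝ → ℂ}
    (hF : LocallyIntegrable F volume) (x₀ : ℝ) (p q : ℂ) :
    ∃ u u' : ℝ → ℂ, Solves V univ u u' (fun x => lam * u x + F x) ∧ u x₀ = p ∧ u' x₀ = q := by
  have hcV : ∀ y : ℝ → ℂ, Continuous y → LocallyIntegrable (fun t => ((V t : ℂ) - lam) * y t)
      volume := by
    intro y hy
    have h1 : LocallyIntegrable (fun t => (V t : ℂ) - lam) volume :=
      LocallyIntegrable.sub (fun x => let ⟨s, hs, h⟩ := hV x; ⟨s, hs, h.ofReal⟩)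
        (locallyIntegrable_const lam)
    rw [← locallyIntegrableOn_univ] at h1 ⊢
    exact h1.mul_continuousOn hy.continuousOn isOpen_univ.isLocallyClosed
  have hn : ∀ {E : Type} [NormedAddCommGroup E] {f : ℝ → E}, LocallyIntegrable f volume →
      LocallyIntegrable (fun t => ‖f t‖) volume := fun hf x =>
    let ⟨s, hs, h⟩ := hf x; ⟨s, hs, h.norm⟩
  obtain ⟨y, hy, e⟩ := exists_continuous_eq_integral (E := ℂ × ℂ)
    -- First-order system for `(u, u')`. The Lipschitz constant only needs the first three terms;
    -- `‖F t‖` is there for the bound on the field at `0`.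
    (a := fun t => 1 + ‖V t‖ + ‖lam‖ + ‖F t‖)
    (G := fun t y => (y.2, ((V t : ℂ) - lam) * y.1 - F t))
    ((((locallyIntegrable_const (1 : ℝ)).add (hn hV)).add (locallyIntegrable_const _)).add (hn hF))
    (fun t => by positivity)
    (fun y hy => by
      intro x
      obtain ⟨s, hs, h1⟩ := (hy.snd.locallyIntegrable (μ := volume)) x
      obtain ⟨s', hs', h2⟩ := ((hcV _ hy.fst).sub hF) x
      exact ⟨s ∩ s', inter_mem hs hs', (h1.mono_set inter_subset_left).prodMk
        (h2.mono_set inter_subset_right)⟩)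
    (fun t y z => by
      have h1 : ‖(V t : ℂ) - lam‖ ≤ ‖V t‖ + ‖lam‖ := by
        simpa using norm_sub_le (V t : ℂ) lam
      have hy1 : ‖y.1 - z.1‖ ≤ ‖y - z‖ := norm_fst_le (y - z)
      have hy2 : ‖y.2 - z.2‖ ≤ ‖y - z‖ := norm_snd_le (y - z)
      refine max_le ?_ ?_
      · refine hy2.trans (le_mul_of_one_le_left (norm_nonneg _) ?_)
        have := norm_nonneg (V t); have := norm_nonneg lam; have := norm_nonneg (F t)
        linarith
      · have : ((V t : ℂ) - lam) * y.1 - F t - (((V t : ℂ) - lam) * z.1 - F t) =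
            ((V t : ℂ) - lam) * (y.1 - z.1) := by ring
        simp only [Prod.mk_sub_mk, this, norm_mul]
        gcongr
        have := norm_nonneg (F t)
        linarith)
    (fun t => by
      have := norm_nonneg (V t); have := norm_nonneg lam; have := norm_nonneg (F t)
      refine max_le ?_ ?_
      · simp only [Prod.snd_zero, norm_zero]; linarith
      · simp only [Prod.fst_zero, mul_zero, zero_sub, norm_neg]; linarith) x₀ (p, q)
  have hs : LocallyIntegrable (fun t => (y t).2) volume := hy.snd.locallyIntegrable
  have hr : LocallyIntegrable (fun t => ((V t : ℂ) - lam) * (y t).1 - F t) volume :=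
    (hcV _ hy.fst).sub hF
  have hi : ∀ x, IntervalIntegrable
      (fun t => ((y t).2, ((V t : ℂ) - lam) * (y t).1 - F t)) volume x₀ x := fun x =>
    ⟨(hs.intervalIntegrable' x₀ x).1.prodMk (hr.intervalIntegrable' x₀ x).1,
      (hs.intervalIntegrable' x₀ x).2.prodMk (hr.intervalIntegrable' x₀ x).2⟩
  have e1 : (fun x => (y x).1) = fun x => p + ∫ t in x₀..x, (y t).2 := by
    funext x
    rw [e x, Prod.fst_add]
    congr 1
    exact ((ContinuousLinearMap.fst ℝ ℂ ℂ).intervalIntegral_comp_comm (hi x)).symm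
  have e2 : (fun x => (y x).2) =
      fun x => q + ∫ t in x₀..x, (((V t : ℂ) - lam) * (y t).1 - F t) := by
    funext x
    rw [e x, Prod.snd_add]
    congr 1
    exact ((ContinuousLinearMap.snd ℝ ℂ ℂ).intervalIntegral_comp_comm (hi x)).symm
  have ac : ∀ {f : ℝ → ℂ} (c : ℂ), LocallyIntegrable f volume →
      LocAC univ (fun x => c + ∫ t in x₀..x, f t) := fun c hf s _ t _ =>
    absolutelyContinuousOnInterval_of_dist_le (K := 1)
      (absolutelyContinuousOnInterval_integral hf x₀ s t) fun _ _ _ _ => by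
        rw [dist_add_left, one_mul]
  refine ⟨fun x => (y x).1, fun x => (y x).2, ⟨?_, fun x _ => ?_, ?_, ?_⟩, ?_, ?_⟩
  · rw [e1]; exact ac p hs
  · rw [hasDerivWithinAt_univ, e1]
    exact (intervalIntegral.integral_hasDerivAt_right (hs.intervalIntegrable' _ _)
      (hy.snd.stronglyMeasurableAtFilter _ _) hy.snd.continuousAt).const_add p
  · rw [e2]; exact ac q hr
  · rw [Measure.restrict_univ]
    filter_upwards [LocallyIntegrable.ae_hasDerivAt_integral hr] with x hx
    refine ⟨((V x : ℂ) - lam) * (y x).1 - F x, ?_, by ring⟩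
    rw [hasDerivWithinAt_univ, e2]
    exact (hx x₀).const_add q
  · simp [e x₀]
  · simp [e x₀]

variable {V : ℝ → ℝ} {I J : Set ℝ} {u u' v v' g h : ℝ → ℂ}

theorem Solves.mono (hu : Solves V I u u' g) (hJ : J ⊆ I) : Solves V J u u' g where
  ac := fun x hx y hy => hu.ac x (hJ hx) y (hJ hy)
  deriv := fun x hx => (hu.deriv x (hJ hx)).mono hJ
  ac' := fun x hx y hy => hu.ac' x (hJ hx) y (hJ hy)
  eqn := by
    filter_upwards [ae_restrict_of_ae_restrict_of_subset hJ hu.eqn] with x ⟨w, hw, e⟩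
    exact ⟨w, hw.mono hJ, e⟩

theorem Solves.neg (hu : Solves V I u u' g) :
    Solves V I (fun x => -u x) (fun x => -u' x) (fun x => -g x) := by
  simpa using hu.const_mul (-1)

theorem Solves.sub (hu : Solves V I u u' g) (hv : Solves V I v v' h) :
    Solves V I (fun x => u x - v x) (fun x => u' x - v' x) (fun x => g x - h x) := by
  simpa [sub_eq_add_neg] using hu.add hv.neg

theorem _root_.HasDerivWithinAt.starRingEnd {f : ℝ → ℂ} {f' : ℂ} {s : Set ℝ} {x : ℝ}
    (hf : HasDerivWithinAt f f' s x) :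
    HasDerivWithinAt (fun x => starRingEnd ℂ (f x)) (starRingEnd ℂ f') s x := by
  simpa using hf.star

theorem Solves.conj (hu : Solves V I u u' g) :
    Solves V I (fun x => starRingEnd ℂ (u x)) (fun x => starRingEnd ℂ (u' x))
      (fun x => starRingEnd ℂ (g x)) where
  ac := fun x hx y hy => absolutelyContinuousOnInterval_of_dist_le (K := 1) (hu.ac x hx y hy)
    fun s _ t _ => by rw [dist_eq_norm, ← map_sub, RCLike.norm_conj, ← dist_eq_norm, one_mul]
  deriv := fun x hx => (hu.deriv x hx).starRingEnd
  ac' := fun x hx y hy => absolutelyContinuousOnInterval_of_dist_le (K := 1) (hu.ac' x hx y hy)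
    fun s _ t _ => by rw [dist_eq_norm, ← map_sub, RCLike.norm_conj, ← dist_eq_norm, one_mul]
  eqn := by
    filter_upwards [hu.eqn] with x ⟨w, hw, e⟩
    exact ⟨starRingEnd ℂ w, hw.starRingEnd, by rw [← e]; simp⟩

theorem Solves.continuousOn (hu : Solves V I u u' g) : ContinuousOn u I :=
  fun x hx => (hu.deriv x hx).continuousWithinAt

/-- The Lagrange identity. -/
theorem Solves.integral_eq (hu : Solves V I u u' g) (hv : Solves V I v v' h) (hI : I.OrdConnected)
    {x y : ℝ} (hx : x ∈ I) (hy : y ∈ I) (hg : IntervalIntegrable g volume x y)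
    (hh : IntervalIntegrable h volume x y) :
    ∫ t in x..y, (g t * v t - u t * h t) =
      (u y * v' y - u' y * v y) - (u x * v' x - u' x * v x) := by
  have hsub : uIcc x y ⊆ I := hI.uIcc_subset hx hy
  have hac := ((hu.ac x hx y hy).fun_smul (hv.ac' x hx y hy)).fun_sub
    ((hu.ac' x hx y hy).fun_smul (hv.ac x hx y hy))
  simp only [smul_eq_mul] at hac
  refine hac.integral_eq_sub ?_ ?_
  · exact (hg.mul_continuousOn (hv.continuousOn.mono hsub)).sub
      (hh.continuousOn_mul (hu.continuousOn.mono hsub))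
  · have h1 := ae_restrict_of_ae_restrict_of_subset hsub hu.eqn
    have h2 := ae_restrict_of_ae_restrict_of_subset hsub hv.eqn
    rw [ae_restrict_iff' measurableSet_uIcc] at h1 h2
    -- Discarding the two endpoints makes `I` a neighbourhood of `t`, so the one-sided derivatives
    -- become genuine ones.
    have n1 : ∀ᵐ t : ℝ, t ≠ x := by simp [ae_iff, measure_singleton]
    have n2 : ∀ᵐ t : ℝ, t ≠ y := by simp [ae_iff, measure_singleton]
    filter_upwards [h1, h2, n1, n2] with t h1 h2 n1 n2 ht
    obtain ⟨w, hw, e⟩ := h1 ht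
    obtain ⟨z, hz, e'⟩ := h2 ht
    have hn : I ∈ 𝓝 t := by
      refine mem_of_superset ?_ hsub
      have : t ∈ Ioo (min x y) (max x y) := by
        rw [mem_uIcc] at ht
        rcases ht with ht | ht
        · rw [min_eq_left (ht.1.trans ht.2), max_eq_right (ht.1.trans ht.2)]
          exact ⟨lt_of_le_of_ne ht.1 n1.symm, lt_of_le_of_ne ht.2 n2⟩
        · rw [min_eq_right (ht.1.trans ht.2), max_eq_left (ht.1.trans ht.2)]
          exact ⟨lt_of_le_of_ne ht.1 n2.symm, lt_of_le_of_ne ht.2 n1⟩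
      exact Icc_mem_nhds this.1 this.2
    have a1 := (hu.deriv t (hsub ht)).hasDerivAt hn
    have a2 := (hv.deriv t (hsub ht)).hasDerivAt hn
    refine ((a1.fun_mul (hz.hasDerivAt hn)).fun_sub ((hw.hasDerivAt hn).fun_mul a2)).congr_deriv ?_
    rw [← e, ← e']
    ring

theorem Solves.wronskian_const {lam : ℂ} (hu : Solves V I u u' fun x => lam * u x)
    (hv : Solves V I v v' fun x => lam * v x) (hI : I.OrdConnected)
    {x y : ℝ} (hx : x ∈ I) (hy : y ∈ I) :
    u y * v' y - u' y * v y = u x * v' x - u' x * v x := by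
  have hsub : uIcc x y ⊆ I := hI.uIcc_subset hx hy
  have := hu.integral_eq hv hI hx hy
    (continuousOn_const.mul (hu.continuousOn.mono hsub)).intervalIntegrable
    (continuousOn_const.mul (hv.continuousOn.mono hsub)).intervalIntegrable
  rw [← sub_eq_zero, ← this]
  simp [mul_assoc, mul_left_comm]

/-- A solution of the homogeneous equation is determined by its Cauchy data. -/
theorem Solves.eq_of_data {lam : ℂ} (hV : LocallyIntegrable V volume) (hI : I.OrdConnected)
    (hu : Solves V I u u' fun x => lam * u x)
    (hv : Solves V I v v' fun x => lam * v x) {t : ℝ} (ht : t ∈ I) (h0 : u t = v t)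
    (h1 : u' t = v' t) : ∀ x ∈ I, u x = v x ∧ u' x = v' x := by
  -- No Gronwall estimate: the Wronskians of `u` and `v` with a fundamental system are constant and
  -- agree at `t`. Cramer's rule recovers the values, the determinant being `1` by `e5`.
  obtain ⟨c, c', hc, c0, c1⟩ := exists_solves hV lam (locallyIntegrable_zero) t 1 0
  obtain ⟨s, s', hs, s0, s1⟩ := exists_solves hV lam (locallyIntegrable_zero) t 0 1
  simp only [add_zero] at hc hs
  intro x hx
  have e1 := hu.wronskian_const (hc.mono (subset_univ I)) hI ht hx
  have e2 := hu.wronskian_const (hs.mono (subset_univ I)) hI ht hx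
  have e3 := hv.wronskian_const (hc.mono (subset_univ I)) hI ht hx
  have e4 := hv.wronskian_const (hs.mono (subset_univ I)) hI ht hx
  have e5 := hc.wronskian_const hs ordConnected_univ (mem_univ t) (mem_univ x)
  simp only [c0, c1, s0, s1, h0, h1] at e1 e2 e3 e4 e5
  constructor
  · linear_combination (v x - u x) * e5 + c x * e2 - s x * e1 - c x * e4 + s x * e3
  · linear_combination (v' x - u' x) * e5 + c' x * e2 - s' x * e1 - c' x * e4 + s' x * e3

end

/-! ### Elements of the maximal domain, half-lines, compactly supported elements -/

section


variable {V : ℝ → ℝ} {I J : Set ℝ} {u u' v v' g h : ℝ → ℂ}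

/-- `u` belongs to the domain of the maximal operator on `I`, with image `g`. -/
structure IsPair (V : ℝ → ℝ) (I : Set ℝ) (u u' g : ℝ → ℂ) : Prop where
  solves : Solves V I u u' g
  memLp : MemLp u 2 (volume.restrict I)
  memLp_rhs : MemLp g 2 (volume.restrict I)

/-- `u` belongs to the domain of the maximal operator on `ℝ`, with image `g`, and vanishes outside
of `(α, β)`. -/
structure IsTest (V : ℝ → ℝ) (α β : ℝ) (u u' g : ℝ → ℂ) : Prop where
  le : α ≤ β
  isPair : IsPair V univ u u' g
  eq_zero : ∀ x ∉ Ioo α β, u x = 0 ∧ u' x = 0 ∧ g x = 0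

theorem IsPair.mono (hu : IsPair V I u u' g) (hJ : J ⊆ I) : IsPair V J u u' g :=
  ⟨hu.solves.mono hJ, hu.memLp.mono_measure (Measure.restrict_mono_set _ hJ),
    hu.memLp_rhs.mono_measure (Measure.restrict_mono_set _ hJ)⟩

theorem IsPair.sub (hu : IsPair V I u u' g) (hv : IsPair V I v v' h) :
    IsPair V I (fun x => u x - v x) (fun x => u' x - v' x) (fun x => g x - h x) :=
  ⟨hu.solves.sub hv.solves, hu.memLp.sub hv.memLp, hu.memLp_rhs.sub hv.memLp_rhs⟩

theorem IsPair.const_mul (c : ℂ) (hu : IsPair V I u u' g) :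
    IsPair V I (fun x => c * u x) (fun x => c * u' x) (fun x => c * g x) :=
  ⟨hu.solves.const_mul c, hu.memLp.const_mul c, hu.memLp_rhs.const_mul c⟩

theorem _root_.MeasureTheory.MemLp.starRingEnd {f : ℝ → ℂ} {μ : Measure ℝ} (hf : MemLp f 2 μ) :
    MemLp (fun x => starRingEnd ℂ (f x)) 2 μ :=
  hf.star

theorem IsPair.conj (hu : IsPair V I u u' g) :
    IsPair V I (fun x => starRingEnd ℂ (u x)) (fun x => starRingEnd ℂ (u' x))
      (fun x => starRingEnd ℂ (g x)) :=
  ⟨hu.solves.conj, hu.memLp.starRingEnd, hu.memLp_rhs.starRingEnd⟩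

theorem IsPair.homogeneous {lam : ℂ} (hu : Solves V I u u' fun x => lam * u x)
    (h2 : MemLp u 2 (volume.restrict I)) : IsPair V I u u' fun x => lam * u x :=
  ⟨hu, h2, h2.const_mul lam⟩

theorem _root_.MeasureTheory.MemLp.mul_integrable {μ : Measure ℝ} (hg : MemLp g 2 μ)
    (hv : MemLp v 2 μ) : Integrable (fun x => g x * v x) μ :=
  MemLp.integrable_mul hg hv

theorem _root_.MeasureTheory.MemLp.intervalIntegrable_of_Icc {x y : ℝ} (hxy : x ≤ y)
    (hg : MemLp g 2 (volume.restrict (Icc x y))) : IntervalIntegrable g volume x y := by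
  rw [intervalIntegrable_iff_integrableOn_Icc_of_le hxy]
  exact hg.integrable (by norm_num)

theorem IsPair.integral_eq (hu : IsPair V I u u' g) (hv : IsPair V I v v' h) {x y : ℝ}
    (hxy : x ≤ y) (hs : Icc x y ⊆ I) :
    ∫ t in Icc x y, (g t * v t - u t * h t) =
      (u y * v' y - u' y * v y) - (u x * v' x - u' x * v x) := by
  have hu' := hu.mono hs
  have hv' := hv.mono hs
  rw [integral_Icc_eq_integral_Ioc, ← intervalIntegral.integral_of_le hxy]
  exact hu'.solves.integral_eq hv'.solves ordConnected_Icc (left_mem_Icc.2 hxy)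
    (right_mem_Icc.2 hxy) (hu'.memLp_rhs.intervalIntegrable_of_Icc hxy)
    (hv'.memLp_rhs.intervalIntegrable_of_Icc hxy)

theorem IsPair.integral_eq_of_eq_zero (hu : IsPair V I u u' g) (hv : IsPair V I v v' h)
    {x y : ℝ} (hxy : x ≤ y) (hs : Icc x y ⊆ I) (h0 : ∀ t ∈ I, t ∉ Icc x y → v t = 0 ∧ h t = 0)
    (hI : MeasurableSet I) :
    ∫ t in I, (g t * v t - u t * h t) =
      (u y * v' y - u' y * v y) - (u x * v' x - u' x * v x) := by
  rw [← hu.integral_eq hv hxy hs]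
  refine setIntegral_eq_of_subset_of_forall_sdiff_eq_zero hI hs fun t ht => ?_
  rw [(h0 t ht.1 ht.2).1, (h0 t ht.1 ht.2).2]
  ring

/-- `I` is a half-line with endpoint `t`, and the Lagrange identity on `I` has sign `σ`. -/
def IsHalfLine (I : Set ℝ) (t : ℝ) (σ : ℂ) : Prop :=
  (I = Ici t ∧ σ = -1) ∨ (I = Iic t ∧ σ = 1)

section HalfLine

variable {t : ℝ} {σ : ℂ}

theorem IsHalfLine.ordConnected (hI : IsHalfLine I t σ) : I.OrdConnected := by
  rcases hI with ⟨rfl, -⟩ | ⟨rfl, -⟩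
  · exact ordConnected_Ici
  · exact ordConnected_Iic

theorem IsHalfLine.mem (hI : IsHalfLine I t σ) : t ∈ I := by
  rcases hI with ⟨rfl, -⟩ | ⟨rfl, -⟩ <;> simp

theorem IsHalfLine.measurableSet (hI : IsHalfLine I t σ) : MeasurableSet I :=
  hI.ordConnected.measurableSet

theorem IsHalfLine.exists_exhaustion (hI : IsHalfLine I t σ) :
    ∃ α β : ℕ → ℝ, (∀ n, α n < β n) ∧ (∀ n, Icc (α n) (β n) ⊆ I) ∧
      (∀ n, Icc (α 0) (β 0) ⊆ Icc (α n) (β n)) ∧ I ⊆ ⋃ n, Icc (α n) (β n) := by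
  rcases hI with ⟨rfl, -⟩ | ⟨rfl, -⟩
  · refine ⟨fun _ => t, fun n => t + n + 1, fun n => ?_, fun n => Icc_subset_Ici_self,
      fun n => Icc_subset_Icc le_rfl ?_, fun x hx => ?_⟩
    · have := n.cast_nonneg (α := ℝ); linarith
    · have := n.cast_nonneg (α := ℝ); push_cast; linarith
    · obtain ⟨n, hn⟩ := exists_nat_ge (x - t)
      exact mem_iUnion.2 ⟨n, hx, by linarith⟩
  · refine ⟨fun n => t - n - 1, fun _ => t, fun n => ?_, fun n => Icc_subset_Iic_self,
      fun n => Icc_subset_Icc ?_ le_rfl, fun x hx => ?_⟩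
    · have := n.cast_nonneg (α := ℝ); linarith
    · have := n.cast_nonneg (α := ℝ); push_cast; linarith
    · obtain ⟨n, hn⟩ := exists_nat_ge (t - x)
      exact mem_iUnion.2 ⟨n, by linarith, hx⟩

theorem IsPair.integral_test (hu : IsPair V I u u' g) {α β : ℝ} (hv : IsTest V α β v v' h)
    (hs : Icc α β ⊆ I) (hI : MeasurableSet I) : ∫ x in I, (g x * v x - u x * h x) = 0 := by
  have h0 : ∀ x ∉ Icc α β, v x = 0 ∧ h x = 0 := fun x hx =>
    have := hv.eq_zero x fun h => hx (Ioo_subset_Icc_self h)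
    ⟨this.1, this.2.2⟩
  rw [hu.integral_eq_of_eq_zero (hv.isPair.mono (subset_univ I)) hv.le hs (fun x _ => h0 x) hI]
  obtain ⟨a1, a2, -⟩ := hv.eq_zero α (by simp)
  obtain ⟨b1, b2, -⟩ := hv.eq_zero β (by simp)
  rw [a1, a2, b1, b2]
  ring

/-- Compact support removes the contribution from infinity, whether or not the limit point case
holds. With data `(0, 1)` or `(1, 0)` for `v`, this reads off `u t` or `u' t` from integrals over
`I`. -/
theorem IsHalfLine.integral_cutoff (hI : IsHalfLine I t σ) (hu : IsPair V I u u' g)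
    (hv : IsTest V (t - 1) (t + 1) v v' h) :
    ∫ x in I, (g x * v x - u x * h x) = σ * (u t * v' t - u' t * v t) := by
  have hm := hI.measurableSet
  obtain ⟨a1, a2, -⟩ := hv.eq_zero (t - 1) (by simp)
  obtain ⟨b1, b2, -⟩ := hv.eq_zero (t + 1) (by simp)
  rcases hI with ⟨rfl, rfl⟩ | ⟨rfl, rfl⟩
  · rw [hu.integral_eq_of_eq_zero (x := t) (y := t + 1) (hv.isPair.mono (subset_univ _))
      (by linarith) Icc_subset_Ici_self (fun x hx hx' => ?_) hm, b1, b2]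
    · ring
    · have := hv.eq_zero x fun h => hx' ⟨hx, h.2.le⟩
      exact ⟨this.1, this.2.2⟩
  · rw [hu.integral_eq_of_eq_zero (x := t - 1) (y := t) (hv.isPair.mono (subset_univ _))
      (by linarith) Icc_subset_Iic_self (fun x hx hx' => ?_) hm, a1, a2]
    · ring
    · have := hv.eq_zero x fun h => hx' ⟨h.1.le, hx⟩
      exact ⟨this.1, this.2.2⟩

end HalfLine

/-- Compactly supported elements of the domain with prescribed Cauchy data. -/
theorem exists_isTest_data (hV : LocallyIntegrable V volume) (t : ℝ) (p q : ℂ) :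
    ∃ u u' g : ℝ → ℂ, IsTest V (t - 1) (t + 1) u u' g ∧ u t = p ∧ u' t = q := by
  -- A smooth bump alone need not lie in the domain, since `V` is only locally integrable. Cutting
  -- off a zero-energy solution `w` cancels `V`: the image is `-(χ'' w + 2 χ' w')`, which is
  -- continuous.
  obtain ⟨w, w', hw, w0, w1⟩ := exists_solves hV 0 locallyIntegrable_zero t p q
  simp only [zero_mul, add_zero] at hw
  let b : ContDiffBump t := ⟨1 / 4, 1 / 2, by norm_num, by norm_num⟩
  set χ : ℝ → ℂ := fun x => (b x : ℂ) with hχ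
  have hb : ContDiff ℝ 3 χ := Complex.ofRealCLM.contDiff.comp b.contDiff
  have hb1 : ContDiff ℝ 2 (deriv χ) := hb.deriv'
  have hb2 : ContDiff ℝ 1 (deriv (deriv χ)) := hb1.deriv'
  have d1 : ∀ x, HasDerivAt χ (deriv χ x) x := fun x =>
    (hb.differentiable (by norm_num) x).hasDerivAt
  have d2 : ∀ x, HasDerivAt (deriv χ) (deriv (deriv χ) x) x := fun x =>
    (hb1.differentiable (by norm_num) x).hasDerivAt
  have wd : ∀ x, HasDerivAt w (w' x) x := fun x => by
    simpa using hw.deriv x (mem_univ x)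
  have wc : Continuous w := continuous_iff_continuousAt.2 fun x => (wd x).continuousAt
  have wc' : Continuous w' := by
    refine continuous_iff_continuousAt.2 fun x => ?_
    exact ((hw.ac' (x - 1) (mem_univ _) (x + 1) (mem_univ _)).continuousOn).continuousAt
      (by rw [uIcc_of_le (by linarith)]; exact Icc_mem_nhds (by linarith) (by linarith))
  have acχ : LocAC univ χ := fun x _ y _ =>
    (hb.of_le (by norm_num)).contDiffOn.absolutelyContinuousOnInterval
  have acχ' : LocAC univ (deriv χ) := fun x _ y _ =>
    (hb1.of_le (by norm_num)).contDiffOn.absolutelyContinuousOnInterval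
  have hone : χ =ᶠ[𝓝 t] fun _ => 1 := by
    filter_upwards [b.eventuallyEq_one] with x hx
    simp [hχ, hx]
  have hz : ∀ x ∉ Ioo (t - 1) (t + 1), χ =ᶠ[𝓝 x] fun _ => 0 := by
    intro x hx
    have hxb : x ∉ Metric.closedBall t (1 / 2) := by
      intro h
      rw [Real.closedBall_eq_Icc] at h
      exact hx ⟨by linarith [h.1], by linarith [h.2]⟩
    filter_upwards [Metric.isClosed_closedBall.isOpen_compl.mem_nhds hxb] with y hy
    have : y ∉ Function.support b := by
      rw [b.support_eq]
      exact fun h => hy (Metric.ball_subset_closedBall h)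
    simp [hχ, Function.notMem_support.1 this]
  have hz' : ∀ x ∉ Ioo (t - 1) (t + 1), χ x = 0 ∧ deriv χ x = 0 ∧ deriv (deriv χ) x = 0 := by
    intro x hx
    refine ⟨(hz x hx).self_of_nhds, ?_, ?_⟩
    · rw [(hz x hx).deriv_eq]; simp
    · rw [(hz x hx).deriv.deriv_eq]; simp
  have hsol : Solves V univ (fun x => χ x * w x) (fun x => deriv χ x * w x + χ x * w' x)
      (fun x => -(deriv (deriv χ) x * w x + 2 * (deriv χ x * w' x))) := by
    refine ⟨fun x hx y hy => (acχ x hx y hy).fun_smul (hw.ac x hx y hy), fun x hx => ?_,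
      fun x hx y hy => ((acχ' x hx y hy).fun_smul (hw.ac x hx y hy)).fun_add
        ((acχ x hx y hy).fun_smul (hw.ac' x hx y hy)), ?_⟩
    · exact ((d1 x).fun_mul (wd x)).hasDerivWithinAt
    · filter_upwards [hw.eqn] with x ⟨z, hz, e⟩
      refine ⟨_, (((d2 x).hasDerivWithinAt.fun_mul (wd x).hasDerivWithinAt).fun_add
        ((d1 x).hasDerivWithinAt.fun_mul hz)), ?_⟩
      linear_combination χ x * e
  have hcs : ∀ f : ℝ → ℂ, Continuous f → (∀ x ∉ Ioo (t - 1) (t + 1), f x = 0) →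
      MemLp f 2 (volume.restrict univ) := by
    intro f hf h0
    rw [Measure.restrict_univ]
    refine hf.memLp_of_hasCompactSupport (HasCompactSupport.intro (isCompact_Icc) fun x hx => h0 x
      fun h => hx (Ioo_subset_Icc_self h))
  refine ⟨_, _, _, ⟨by linarith, ⟨hsol, hcs _ (hb.continuous.mul wc) fun x hx => by
    simp [hz' x hx], hcs _ (((hb2.continuous.mul wc).add (continuous_const.mul
      (hb1.continuous.mul wc'))).neg) fun x hx => by simp [hz' x hx]⟩, fun x hx => by
        simp [hz' x hx]⟩, ?_, ?_⟩
  · simp [hone.self_of_nhds, w0]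
  · simp [hone.self_of_nhds, hone.deriv_eq, w1]

end

/-! ### The adjoint of the minimal operator -/

section


variable {V : ℝ → ℝ} {I : Set ℝ} {u u' v v' g h : ℝ → ℂ}

open scoped ComplexInnerProductSpace in
theorem inner_toLp {μ : Measure ℝ} {f g : ℝ → ℂ} (hf : MemLp f 2 μ) (hg : MemLp g 2 μ) :
    ⟪hf.toLp f, hg.toLp g⟫ = ∫ x, starRingEnd ℂ (f x) * g x ∂μ := by
  rw [L2.inner_def]
  refine integral_congr_ae ?_
  filter_upwards [hf.coeFn_toLp, hg.coeFn_toLp] with x h1 h2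
  rw [h1, h2, RCLike.inner_apply, mul_comm]

open scoped ComplexInnerProductSpace in
/-- In `L²`, a function which annihilates the annihilator of `c, s` is a combination of `c, s`. -/
theorem ae_eq_combination {μ : Measure ℝ} {c s r : ℝ → ℂ} (hc : MemLp c 2 μ) (hs : MemLp s 2 μ)
    (hr : MemLp r 2 μ) (h : ∀ F : ℝ → ℂ, MemLp F 2 μ → ∫ x, F x * c x ∂μ = 0 →
      ∫ x, F x * s x ∂μ = 0 → ∫ x, F x * r x ∂μ = 0) :
    ∃ p q : ℂ, r =ᵐ[μ] fun x => p * c x + q * s x := by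
  set S : Submodule ℂ (Lp ℂ 2 μ) := Submodule.span ℂ {hc.toLp c, hs.toLp s} with hS
  have hfin : FiniteDimensional ℂ S := FiniteDimensional.span_of_finite ℂ (by simp)
  have hmem : hr.toLp r ∈ S := by
    -- A finite-dimensional span equals its double orthogonal complement.
    rw [← S.orthogonal_orthogonal, Submodule.mem_orthogonal]
    intro G hG
    have hG2 : MemLp G 2 μ := Lp.memLp G
    have e : hG2.toLp G = G := Lp.toLp_coeFn G hG2
    have hc0 : ⟪G, hc.toLp c⟫ = 0 :=
      Submodule.inner_left_of_mem_orthogonal (Submodule.subset_span (by simp)) hG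
    have hs0 : ⟪G, hs.toLp s⟫ = 0 :=
      Submodule.inner_left_of_mem_orthogonal (Submodule.subset_span (by simp)) hG
    rw [← e, inner_toLp] at hc0 hs0 ⊢
    exact h _ hG2.starRingEnd hc0 hs0
  obtain ⟨p, q, e⟩ := Submodule.mem_span_pair.1 hmem
  refine ⟨p, q, ?_⟩
  filter_upwards [hr.coeFn_toLp, hc.coeFn_toLp, hs.coeFn_toLp,
    Lp.coeFn_add (p • hc.toLp c) (q • hs.toLp s), Lp.coeFn_smul p (hc.toLp c),
    Lp.coeFn_smul q (hs.toLp s)] with x h1 h2 h3 h4 h5 h6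
  rw [← h1, ← e, h4, Pi.add_apply, h5, h6, Pi.smul_apply, Pi.smul_apply, h2, h3, smul_eq_mul,
    smul_eq_mul]

theorem Solves.continuous (hu : Solves V univ u u' g) : Continuous u :=
  continuousOn_univ.1 hu.continuousOn

theorem _root_.Continuous.memLp_Icc (hu : Continuous u) (α β : ℝ) :
    MemLp u 2 (volume.restrict (Icc α β)) := by
  obtain ⟨C, hC⟩ := isCompact_Icc.exists_bound_of_continuousOn (hu.continuousOn (s := Icc α β))
  exact MemLp.of_bound hu.aestronglyMeasurable C
    ((ae_restrict_mem measurableSet_Icc).mono fun x hx => hC x hx)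

/-- A function on `[α, β]` orthogonal to two independent homogeneous solutions is the image of an
element of the domain supported in `[α, β]`. -/
theorem exists_isTest_of_orthogonal (hV : LocallyIntegrable V volume) {c c' s s' : ℝ → ℂ}
    (hc : Solves V univ c c' fun _ => 0) (hs : Solves V univ s s' fun _ => 0)
    {α β : ℝ} (hαβ : α ≤ β) (hw : c β * s' β - c' β * s β = 1) {F : ℝ → ℂ}
    (hF : MemLp F 2 (volume.restrict (Icc α β))) (hFc : ∫ x in Icc α β, F x * c x = 0)
    (hFs : ∫ x in Icc α β, F x * s x = 0) :
    ∃ u u', IsTest V α β u u' ((Ioo α β).indicator F) := by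
  have hF0 : MemLp ((Ioo α β).indicator F) 2 volume :=
    (memLp_indicator_iff_restrict measurableSet_Ioo).2
      (hF.mono_measure (Measure.restrict_mono_set _ Ioo_subset_Icc_self))
  -- Zero data at `α` are imposed; orthogonality of `F` to `c` and `s` forces zero data at `β`
  -- through the Lagrange identity. By uniqueness `u` vanishes on both sides of the interval.
  obtain ⟨u, u', hu, u0, u1⟩ := exists_solves hV 0 (hF0.locallyIntegrable (by norm_num)) α 0 0
  simp only [zero_mul, zero_add] at hu
  have pu : IsPair V (Icc α β) u u' ((Ioo α β).indicator F) :=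
    ⟨hu.mono (subset_univ _), hu.continuous.memLp_Icc α β, hF0.restrict _⟩
  have hom : ∀ {w w'}, Solves V univ w w' (fun _ => 0) → IsPair V (Icc α β) w w' (fun _ => 0) :=
    fun hw => ⟨hw.mono (subset_univ _), hw.continuous.memLp_Icc α β, MemLp.zero'⟩
  have hae : (Ioo α β).indicator F =ᵐ[volume.restrict (Icc α β)] F := by
    have : ∀ᵐ x ∂(volume.restrict (Icc α β)), x ∈ Ioo α β := by
      rw [← restrict_Ioo_eq_restrict_Icc]
      exact ae_restrict_mem measurableSet_Ioo
    filter_upwards [this] with x hx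
    rw [indicator_of_mem hx]
  have green : ∀ {w w'}, Solves V univ w w' (fun _ => 0) → ∫ x in Icc α β, F x * w x = 0 →
      u β * w' β - u' β * w β = 0 := by
    intro w w' hw h0
    have := pu.integral_eq (hom hw) hαβ subset_rfl
    rw [u0, u1] at this
    have e : ∫ x in Icc α β, ((Ioo α β).indicator F x * w x - u x * 0) =
        ∫ x in Icc α β, F x * w x := by
      refine integral_congr_ae ?_
      filter_upwards [hae] with x hx
      rw [hx]; ring
    rw [e, h0] at this
    linear_combination -this
  have gc := green hc hFc
  have gs := green hs hFs
  have uβ : u β = 0 := by linear_combination (-u β) * hw + c β * gs - s β * gc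
  have uβ' : u' β = 0 := by linear_combination (-u' β) * hw + c' β * gs - s' β * gc
  have side : ∀ (J : Set ℝ) (t : ℝ), J.OrdConnected → t ∈ J → J ∩ Ioo α β = ∅ → u t = 0 →
      u' t = 0 → ∀ x ∈ J, u x = 0 ∧ u' x = 0 := by
    intro J t hJ ht hJ0 h0 h1
    have hu' : Solves V J u u' fun x => 0 * u x :=
      (hu.mono (subset_univ J)).congr_rhs (by
        filter_upwards [ae_restrict_mem hJ.measurableSet] with x hx
        rw [zero_mul, indicator_of_notMem]
        intro h
        exact (hJ0 ▸ mem_inter hx h : x ∈ (∅ : Set ℝ)))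
    have hz : Solves V J (fun _ => 0) (fun _ => 0) fun x => 0 * (0 : ℂ) := by
      simpa using Solves.zero V J
    exact hu'.eq_of_data hV hJ hz ht h0 h1
  have hz : ∀ x ∉ Ioo α β, u x = 0 ∧ u' x = 0 ∧ (Ioo α β).indicator F x = 0 := by
    intro x hx
    have h1 : u x = 0 ∧ u' x = 0 := by
      rcases le_or_gt x α with h | h
      · exact side (Iic α) α ordConnected_Iic (mem_Iic.2 le_rfl) (by
          ext y; simp only [mem_inter_iff, mem_Iic, mem_Ioo, mem_empty_iff_false, iff_false]
          intro hy; linarith [hy.1, hy.2.1]) u0 u1 x h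
      · have h' : β ≤ x := by
          by_contra h'
          exact hx ⟨h, not_le.1 h'⟩
        exact side (Ici β) β ordConnected_Ici (mem_Ici.2 le_rfl) (by
          ext y; simp only [mem_inter_iff, mem_Ici, mem_Ioo, mem_empty_iff_false, iff_false]
          intro hy; linarith [hy.1, hy.2.2]) uβ uβ' x h'
    exact ⟨h1.1, h1.2, indicator_of_notMem hx _⟩
  refine ⟨u, u', hαβ, ⟨hu, ?_, ?_⟩, hz⟩
  · rw [Measure.restrict_univ]
    exact hu.continuous.memLp_of_hasCompactSupport (HasCompactSupport.intro isCompact_Icc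
      fun x hx => (hz x fun h => hx (Ioo_subset_Icc_self h)).1)
  · rwa [Measure.restrict_univ]

/-- Homogeneous solutions are linearly independent as soon as their Wronskian does not vanish. -/
theorem eq_of_ae_eq_combination {c c' s s' : ℝ → ℂ} (hc : Solves V univ c c' fun _ => 0)
    (hs : Solves V univ s s' fun _ => 0) {α β : ℝ} (hαβ : α < β)
    (hw : ∀ x, c x * s' x - c' x * s x = 1) {p q p₁ q₁ : ℂ}
    (h : (fun x => p * c x + q * s x) =ᵐ[volume.restrict (Icc α β)]
      fun x => p₁ * c x + q₁ * s x) : p = p₁ ∧ q = q₁ := by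
  have h1 : EqOn (fun x => p * c x + q * s x) (fun x => p₁ * c x + q₁ * s x) (Ioo α β) :=
    Measure.eqOn_open_of_ae_eq (μ := volume)
      (ae_restrict_of_ae_restrict_of_subset Ioo_subset_Icc_self h) isOpen_Ioo
      ((continuous_const.mul hc.continuous).add (continuous_const.mul hs.continuous)).continuousOn
      ((continuous_const.mul hc.continuous).add (continuous_const.mul hs.continuous)).continuousOn
  obtain ⟨x, hx⟩ := nonempty_Ioo.2 hαβ
  have dc : HasDerivAt c (c' x) x := by simpa using hc.deriv x (mem_univ x)
  have ds : HasDerivAt s (s' x) x := by simpa using hs.deriv x (mem_univ x)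
  have e0 := h1 hx
  have e1 : p * c' x + q * s' x = p₁ * c' x + q₁ * s' x :=
    ((dc.const_mul p).fun_add (ds.const_mul q)).unique
      (((dc.const_mul p₁).fun_add (ds.const_mul q₁)).congr_of_eventuallyEq
        (h1.eventuallyEq_of_mem (isOpen_Ioo.mem_nhds hx)))
  simp only at e0
  constructor
  · linear_combination (p₁ - p) * hw x + s' x * e0 - s x * e1
  · linear_combination (q₁ - q) * hw x - c' x * e0 + c x * e1

/-- The adjoint of the minimal operator is the maximal operator. -/
theorem exists_solves_of_weak (hV : LocallyIntegrable V volume) (hI : MeasurableSet I)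
    {α β : ℕ → ℝ} (hαβ : ∀ n, α n < β n) (hs : ∀ n, Icc (α n) (β n) ⊆ I)
    (h0 : ∀ n, Icc (α 0) (β 0) ⊆ Icc (α n) (β n)) (hc : I ⊆ ⋃ n, Icc (α n) (β n))
    {k l : ℝ → ℂ} (hk : MemLp k 2 (volume.restrict I)) (hl : MemLp l 2 (volume.restrict I))
    (hweak : ∀ α β u u' F, Icc α β ⊆ I → IsTest V α β u u' F →
      ∫ x in I, (F x * k x - u x * l x) = 0) :
    ∃ w w', k =ᵐ[volume.restrict I] w ∧ Solves V I w w' l := by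
  have hl0 : MemLp (I.indicator l) 2 volume := (memLp_indicator_iff_restrict hI).2 hl
  -- With a particular solution `v` for the right-hand side `l`, the weak identity says that `k - v`
  -- annihilates every `F` orthogonal to `c` and `s` on a compact interval. So `k - v` is a
  -- combination of `c` and `s` there.
  obtain ⟨v, v', hv, -, -⟩ := exists_solves hV 0 (hl0.locallyIntegrable (by norm_num)) 0 0 0
  obtain ⟨c, c', hc', c0, c1⟩ := exists_solves hV 0 locallyIntegrable_zero 0 1 0
  obtain ⟨s, s', hs', s0, s1⟩ := exists_solves hV 0 locallyIntegrable_zero 0 0 1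
  have hw : ∀ x, c x * s' x - c' x * s x = 1 := by
    simp only [add_zero] at hc' hs'
    intro x
    rw [hc'.wronskian_const hs' ordConnected_univ (mem_univ 0) (mem_univ x), c0, c1, s0, s1]
    ring
  simp only [zero_mul, zero_add] at hv hc' hs'
  have loc : ∀ n, ∃ p q : ℂ, (fun x => k x - v x) =ᵐ[volume.restrict (Icc (α n) (β n))]
      fun x => p * c x + q * s x := by
    intro n
    have hle := (hαβ n).le
    have hkn := hk.mono_measure (Measure.restrict_mono_set volume (hs n))
    have hvn := hv.continuous.memLp_Icc (α n) (β n)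
    refine ae_eq_combination (hc'.continuous.memLp_Icc _ _) (hs'.continuous.memLp_Icc _ _)
      (hkn.sub hvn) fun F hF hFc hFs => ?_
    obtain ⟨u, u', hu⟩ := exists_isTest_of_orthogonal hV hc' hs' hle (hw _) hF hFc hFs
    have e1 := hweak _ _ _ _ _ (hs n) hu
    rw [setIntegral_eq_of_subset_of_forall_sdiff_eq_zero hI (hs n) fun x hx => by
      obtain ⟨a1, -, a2⟩ := hu.eq_zero x fun h => hx.2 (Ioo_subset_Icc_self h)
      rw [a1, a2]; ring] at e1
    have pv : IsPair V (Icc (α n) (β n)) v v' (I.indicator l) :=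
      ⟨hv.mono (subset_univ _), hvn, hl0.restrict _⟩
    have pu := hu.isPair.mono (subset_univ (Icc (α n) (β n)))
    have e2 := pu.integral_eq pv hle subset_rfl
    obtain ⟨a1, a2, -⟩ := hu.eq_zero (α n) (by simp)
    obtain ⟨b1, b2, -⟩ := hu.eq_zero (β n) (by simp)
    rw [a1, a2, b1, b2] at e2
    have e3 : ∫ x in Icc (α n) (β n), F x * (k x - v x) =
        (∫ x in Icc (α n) (β n), ((Ioo (α n) (β n)).indicator F x * k x - u x * l x)) -
        ∫ x in Icc (α n) (β n), ((Ioo (α n) (β n)).indicator F x * v x - u x * I.indicator l x) := by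
      rw [← integral_sub]
      · refine integral_congr_ae ?_
        rw [← restrict_Ioo_eq_restrict_Icc]
        filter_upwards [ae_restrict_mem measurableSet_Ioo] with x hx
        rw [indicator_of_mem hx, indicator_of_mem (hs n (Ioo_subset_Icc_self hx))]
        ring
      · exact (pu.memLp_rhs.mul_integrable hkn).sub (pu.memLp.mul_integrable
          (hl.mono_measure (Measure.restrict_mono_set volume (hs n))))
      · exact (pu.memLp_rhs.mul_integrable hvn).sub (pu.memLp.mul_integrable pv.memLp_rhs)
    rw [e3, e1, e2]
    ring
  choose p q hpq using loc
  -- All intervals contain the zeroth one, and `c`, `s` are independent on it, so the local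
  -- coefficients agree.
  have hconst : ∀ n, p 0 = p n ∧ q 0 = q n := fun n =>
    eq_of_ae_eq_combination hc' hs' (hαβ 0) hw
      ((hpq 0).symm.trans (ae_restrict_of_ae_restrict_of_subset (h0 n) (hpq n)))
  refine ⟨fun x => v x + (p 0 * c x + q 0 * s x), fun x => v' x + (p 0 * c' x + q 0 * s' x), ?_,
    ((hv.add ((hc'.const_mul (p 0)).add (hs'.const_mul (q 0)))).mono
      (subset_univ I)).congr_rhs ?_⟩
  · refine ae_restrict_of_ae_restrict_of_subset hc ((ae_restrict_iUnion_iff _ _).2 fun n => ?_)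
    filter_upwards [hpq n] with x hx
    rw [(hconst n).1, (hconst n).2, ← hx]
    ring
  · filter_upwards [ae_restrict_mem hI] with x hx
    rw [indicator_of_mem hx]
    ring

end

/-! ### Von Neumann's decomposition and Green's identity in the limit point case -/

section


variable {V : ℝ → ℝ} {I : Set ℝ} {u u' v v' g h : ℝ → ℂ}

section VonNeumann

open scoped ComplexInnerProductSpace

variable {E : Type*} [NormedAddCommGroup E] [InnerProductSpace ℂ E] [CompleteSpace E]

/-- Von Neumann's decomposition of the graph `G` of the adjoint of a symmetric relation `T`. -/
theorem exists_vonNeumann_decomposition (G : Submodule ℂ (E × E)) (T : Set (E × E))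
    (hG : ∀ p : E × E, p ∈ G ↔ ∀ t ∈ T, ⟪t.2, p.1⟫ = ⟪t.1, p.2⟫) (hT : T ⊆ G)
    {p : E × E} (hp : p ∈ G) :
    ∃ (p₀ : E × E) (x y : E), p₀ ∈ G ∧ (x, Complex.I • x) ∈ G ∧ (y, -Complex.I • y) ∈ G ∧
      p = p₀ + (x, Complex.I • x) + (y, -Complex.I • y) ∧
      ∀ q ∈ G, ⟪q.2, p₀.1⟫ = ⟪q.1, p₀.2⟫ := by
  -- The orthogonal complement of the rotated graph: it is closed, contains `T`, and lies in `G` by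
  -- `hKG`. Projecting onto it leaves a remainder `r` orthogonal to `T`.
  let K : Submodule ℂ (WithLp 2 (E × E)) :=
    (Submodule.span ℂ ((fun q : E × E => WithLp.toLp 2 (q.2, -q.1)) '' G))ᗮ
  have hK : ∀ z ∈ K, ∀ q ∈ G, ⟪q.2, z.fst⟫ = ⟪q.1, z.snd⟫ := by
    intro z hz q hq
    have := Submodule.inner_right_of_mem_orthogonal (Submodule.subset_span (mem_image_of_mem _ hq))
      hz
    rw [WithLp.prod_inner_apply] at this
    simpa [inner_neg_left, add_neg_eq_zero] using this
  have hKG : ∀ z ∈ K, (z.fst, z.snd) ∈ G := fun z hz => (hG _).2 fun t ht => hK z hz t (hT ht)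
  have hTK : ∀ t ∈ T, WithLp.toLp 2 t ∈ K := by
    intro t ht
    rw [Submodule.mem_orthogonal]
    intro w hw
    induction hw using Submodule.span_induction with
    | mem w hw =>
      obtain ⟨q, hq, rfl⟩ := hw
      have := (hG q).1 hq t ht
      rw [← inner_conj_symm, ← inner_conj_symm t.1, (starRingEnd ℂ).injective.eq_iff] at this
      rw [WithLp.prod_inner_apply]
      simp [inner_neg_left, this]
    | zero => simp
    | add a b _ _ ha hb => rw [inner_add_left, ha, hb, add_zero]
    | smul c a _ ha => rw [inner_smul_left, ha, mul_zero]
  have hKc : CompleteSpace K := (Submodule.isClosed_orthogonal _).completeSpace_coe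
  have hKp : K.HasOrthogonalProjection := Submodule.HasOrthogonalProjection.ofCompleteSpace K
  obtain ⟨z, hz, r, hr, e⟩ := K.exists_add_mem_mem_orthogonal (WithLp.toLp 2 p)
  have hzr : (r.fst, r.snd) = p - (z.fst, z.snd) := by
    have := congrArg WithLp.ofLp e
    simp only [WithLp.ofLp_add] at this
    exact (sub_eq_of_eq_add' this).symm
  have hrG : (r.fst, r.snd) ∈ G := by
    rw [hzr]; exact G.sub_mem hp (hKG z hz)
  -- If `G` is the graph of `B`, then `B r₁ = r₂` and `B r₂ = -r₁`; on such a pair `B² = -1`, and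
  -- `r₁ ∓ i r₂` are eigenvectors for `± i`.
  have hrG' : (r.snd, -r.fst) ∈ G := by
    refine (hG _).2 fun t ht => ?_
    have := Submodule.inner_right_of_mem_orthogonal (hTK t ht) hr
    rw [WithLp.prod_inner_apply] at this
    have h2 : ⟪t.1, r.fst⟫ + ⟪t.2, r.snd⟫ = 0 := this
    simp only [inner_neg_right]
    linear_combination h2
  refine ⟨(z.fst, z.snd), (1 / 2 : ℂ) • (r.fst - Complex.I • r.snd),
    (1 / 2 : ℂ) • (r.fst + Complex.I • r.snd), hKG z hz, ?_, ?_, ?_, hK z hz⟩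
  · convert G.smul_mem (1 / 2 : ℂ) (G.sub_mem hrG (G.smul_mem Complex.I hrG')) using 1
    ext1
    · simp
    · simp only [Prod.smul_snd, Prod.snd_sub, smul_neg, smul_sub, smul_smul]
      rw [mul_left_comm, Complex.I_mul_I, mul_comm Complex.I]
      module
  · convert G.smul_mem (1 / 2 : ℂ) (G.add_mem hrG (G.smul_mem Complex.I hrG')) using 1
    ext1
    · simp
    · simp only [Prod.smul_snd, Prod.snd_add, smul_neg, smul_add, smul_smul]
      rw [show -Complex.I * (1 / 2 * Complex.I) = 1 / 2 by
        rw [mul_left_comm, neg_mul, Complex.I_mul_I]; ring]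
      module
  · have : p = (z.fst, z.snd) + (r.fst, r.snd) := by rw [hzr]; abel
    nth_rewrite 1 [this]
    rw [add_assoc]
    congr 1
    ext1
    · simp only [Prod.fst_add]; module
    · simp only [Prod.snd_add, smul_smul, smul_sub, smul_add]
      rw [show -Complex.I * (1 / 2 * Complex.I) = 1 / 2 by
        linear_combination (-1/2 : ℂ) * Complex.I_mul_I, show Complex.I * (1 / 2 * Complex.I) =
          -(1 / 2) by linear_combination (1/2 : ℂ) * Complex.I_mul_I]
      module

end VonNeumann

theorem IsPair.mem_maxGraph (hu : IsPair V I u u' g) :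
    (hu.memLp.toLp u, hu.memLp_rhs.toLp g) ∈ maxGraph V I :=
  ⟨u, u', hu.memLp.coeFn_toLp, hu.solves.congr_rhs hu.memLp_rhs.coeFn_toLp.symm⟩

theorem exists_isPair {p : L2 I × L2 I} (hp : p ∈ maxGraph V I) :
    ∃ u u', p.1 =ᵐ[volume.restrict I] u ∧ IsPair V I u u' p.2 := by
  obtain ⟨u, u', h1, h2⟩ := hp
  exact ⟨u, u', h1, h2, (Lp.memLp p.1).ae_eq h1, Lp.memLp p.2⟩

theorem IsPair.mem_maxGraph_of_ae (hu : IsPair V I u u' g) {p : L2 I × L2 I}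
    (h1 : p.1 =ᵐ[volume.restrict I] u) (h2 : p.2 =ᵐ[volume.restrict I] g) : p ∈ maxGraph V I :=
  ⟨u, u', h1, hu.solves.congr_rhs h2.symm⟩

open scoped ComplexInnerProductSpace in
theorem inner_sub_inner_eq {f₁ g₁ f₂ g₂ : L2 I} (h1 : f₁ =ᵐ[volume.restrict I] u)
    (h2 : g₁ =ᵐ[volume.restrict I] g) (h3 : f₂ =ᵐ[volume.restrict I] v)
    (h4 : g₂ =ᵐ[volume.restrict I] h) :
    ⟪g₁, f₂⟫ - ⟪f₁, g₂⟫ =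
      ∫ x in I, (starRingEnd ℂ (g x) * v x - starRingEnd ℂ (u x) * h x) := by
  rw [L2.inner_def, L2.inner_def, ← integral_sub (L2.integrable_inner _ _)
    (L2.integrable_inner _ _)]
  refine integral_congr_ae ?_
  filter_upwards [h1, h2, h3, h4] with x h1 h2 h3 h4
  rw [h1, h2, h3, h4, RCLike.inner_apply, RCLike.inner_apply]
  ring

theorem mem_eigenspace_iff (hI : I.OrdConnected) {lam : ℂ} {f : L2 I} :
    f ∈ eigenspace (maxOperator V I) lam ↔ (f, lam • f) ∈ maxGraph V I := by
  rw [← maxOperator_graph V hI, LinearPMap.mem_graph_iff]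
  constructor
  · rintro ⟨hf, e⟩
    exact ⟨⟨f, hf⟩, rfl, e⟩
  · rintro ⟨y, hy, e⟩
    simp only at hy
    subst hy
    exact ⟨y.2, e⟩

theorem IsTest.conj {α β : ℝ} (hu : IsTest V α β u u' g) :
    IsTest V α β (fun x => starRingEnd ℂ (u x)) (fun x => starRingEnd ℂ (u' x))
      (fun x => starRingEnd ℂ (g x)) :=
  ⟨hu.le, hu.isPair.conj, fun x hx => by
    obtain ⟨h1, h2, h3⟩ := hu.eq_zero x hx
    simp [h1, h2, h3]⟩

open scoped ComplexInnerProductSpace in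
/-- Elements of the maximal domain on a half-line, modulo the two defect spaces. -/
theorem IsHalfLine.exists_decomposition (hV : LocallyIntegrable V volume) {t : ℝ} {σ : ℂ}
    (hI : IsHalfLine I t σ) {p : L2 I × L2 I} (hp : p ∈ maxGraph V I) :
    ∃ (p₀ : L2 I × L2 I) (x y : L2 I), p₀ ∈ maxGraph V I ∧ (x, Complex.I • x) ∈ maxGraph V I ∧
      (y, -Complex.I • y) ∈ maxGraph V I ∧ p = p₀ + (x, Complex.I • x) + (y, -Complex.I • y) ∧
      ∀ q ∈ maxGraph V I, ⟪q.2, p₀.1⟫ = ⟪q.1, p₀.2⟫ := by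
  have hm := hI.measurableSet
  refine exists_vonNeumann_decomposition (maxGraph V I) {p | ∃ α β u u' F, Icc α β ⊆ I ∧
    IsTest V α β u u' F ∧ p.1 =ᵐ[volume.restrict I] u ∧ p.2 =ᵐ[volume.restrict I] F}
    (fun q => ⟨?_, fun hq => ?_⟩) ?_ hp
  · rintro hq s ⟨α, β, u, u', F, hs, ht, h1, h2⟩
    obtain ⟨w, w', hw, hp⟩ := exists_isPair hq
    rw [← sub_eq_zero, inner_sub_inner_eq h1 h2 hw (ae_eq_refl _), ← neg_eq_zero, ← integral_neg,
      ← hp.integral_test ht.conj hs hm]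
    refine integral_congr_ae (Eventually.of_forall fun x => ?_)
    simp only
    ring
  · obtain ⟨α, β, h1, h2, h3, h4⟩ := hI.exists_exhaustion
    obtain ⟨w, w', hw, hs⟩ := exists_solves_of_weak hV hm h1 h2 h3 h4 (Lp.memLp q.1) (Lp.memLp q.2)
      fun α β u u' F hs ht => by
        have hc := ht.conj.isPair.mono (subset_univ I)
        have := sub_eq_zero.2 (hq (hc.memLp.toLp _, hc.memLp_rhs.toLp _) ⟨α, β, _, _, _, hs, ht.conj,
          hc.memLp.coeFn_toLp, hc.memLp_rhs.coeFn_toLp⟩)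
        rw [inner_sub_inner_eq hc.memLp.coeFn_toLp hc.memLp_rhs.coeFn_toLp (ae_eq_refl _)
          (ae_eq_refl _)] at this
        simpa using this
    exact ⟨w, w', hw, hs⟩
  · rintro q ⟨α, β, u, u', F, hs, ht, h1, h2⟩
    exact (ht.isPair.mono (subset_univ I)).mem_maxGraph_of_ae h1 h2

/-- The Lagrange identity on the half-line `I` holds without a contribution from infinity. -/
def GreenAt (V : ℝ → ℝ) (I : Set ℝ) (t : ℝ) (σ : ℂ) : Prop :=
  ∀ ⦃u u' g v v' h : ℝ → ℂ⦄, IsPair V I u u' g → IsPair V I v v' h →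
    ∫ x in I, (g x * v x - u x * h x) = σ * (u t * v' t - u' t * v t)

-- By von Neumann, the domain modulo elements with vanishing boundary form is spanned by one defect
-- element for each sign. Cauchy data at `t` are arbitrary and already account for two dimensions,
-- so an element with zero data at `t` has vanishing boundary form. Subtracting from `u` a compactly
-- supported element with the same data reduces the general case to this one.
open scoped ComplexInnerProductSpace in
theorem IsHalfLine.greenAt (hV : LocallyIntegrable V volume) {t : ℝ} {σ : ℂ}
    (hI : IsHalfLine I t σ) (hlp : LimitPoint V I) : GreenAt V I t σ := by
  have hσ : σ ≠ 0 := by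
    rcases hI with ⟨-, rfl⟩ | ⟨-, rfl⟩ <;> simp
  obtain ⟨⟨x, hx⟩, -, hx1⟩ := finrank_eq_one_iff'.1 hlp.1
  obtain ⟨⟨y, hy⟩, -, hy1⟩ := finrank_eq_one_iff'.1 hlp.2
  rw [mem_eigenspace_iff hI.ordConnected] at hx hy
  obtain ⟨a, a', ha, pa⟩ := exists_isPair hx
  obtain ⟨b, b', hb, pb⟩ := exists_isPair hy
  -- the boundary values are spanned by those of the defect elements
  have dec : ∀ {u u' g : ℝ → ℂ}, IsPair V I u u' g → ∃ c d : ℂ,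
      u t = c * a t + d * b t ∧ u' t = c * a' t + d * b' t ∧
      (c = 0 → d = 0 → ∀ {v v' h : ℝ → ℂ}, IsPair V I v v' h →
        ∫ x in I, (g x * v x - u x * h x) = 0) := by
    intro u u' g hu
    obtain ⟨p₀, x₀, y₀, hp₀, hx₀, hy₀, e, hq⟩ := hI.exists_decomposition hV hu.mem_maxGraph
    obtain ⟨c, hc⟩ := hx1 ⟨x₀, (mem_eigenspace_iff hI.ordConnected).2 hx₀⟩
    obtain ⟨d, hd⟩ := hy1 ⟨y₀, (mem_eigenspace_iff hI.ordConnected).2 hy₀⟩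
    simp only [Subtype.mk.injEq, SetLike.mk_smul_mk] at hc hd
    have hp₀1 : p₀.1 = hu.memLp.toLp u - c • x - d • y := by
      have := congrArg Prod.fst e
      simp only [Prod.fst_add, ← hc, ← hd] at this
      rw [this]; abel
    have hp₀2 : p₀.2 = hu.memLp_rhs.toLp g - c • Complex.I • x - d • (-Complex.I • y) := by
      have := congrArg Prod.snd e
      simp only [Prod.snd_add, ← hc, ← hd] at this
      rw [this, smul_comm c, smul_comm d]; abel
    have pz := (hu.sub (pa.const_mul c)).sub (pb.const_mul d)
    have ae1 : p₀.1 =ᵐ[volume.restrict I] fun s => u s - c * a s - d * b s := by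
      rw [hp₀1]
      filter_upwards [hu.memLp.coeFn_toLp, ha, hb, Lp.coeFn_sub (hu.memLp.toLp u - c • x) (d • y),
        Lp.coeFn_sub (hu.memLp.toLp u) (c • x), Lp.coeFn_smul c x, Lp.coeFn_smul d y]
        with s h1 h2 h3 h4 h5 h6 h7
      rw [h4, Pi.sub_apply, h5, Pi.sub_apply, h6, h7, Pi.smul_apply, Pi.smul_apply, h1, h2, h3,
        smul_eq_mul, smul_eq_mul]
    have ae2 : p₀.2 =ᵐ[volume.restrict I] fun s => g s - c * (Complex.I • x : L2 I) s
        - d * (-Complex.I • y : L2 I) s := by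
      rw [hp₀2]
      filter_upwards [hu.memLp_rhs.coeFn_toLp,
        Lp.coeFn_sub (hu.memLp_rhs.toLp g - c • Complex.I • x) (d • (-Complex.I • y)),
        Lp.coeFn_sub (hu.memLp_rhs.toLp g) (c • Complex.I • x), Lp.coeFn_smul c (Complex.I • x),
        Lp.coeFn_smul d (-Complex.I • y)] with s h1 h4 h5 h6 h7
      rw [h4, Pi.sub_apply, h5, Pi.sub_apply, h6, h7, Pi.smul_apply, Pi.smul_apply, h1,
        smul_eq_mul, smul_eq_mul]
    have green : ∀ {v v' h : ℝ → ℂ}, IsPair V I v v' h →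
        ∫ s in I, ((g s - c * (Complex.I • x : L2 I) s - d * (-Complex.I • y : L2 I) s) * v s -
          (u s - c * a s - d * b s) * h s) = 0 := by
      intro v v' h hv
      have h0 := sub_eq_zero.2 (hq _ hv.conj.mem_maxGraph)
      rw [inner_sub_inner_eq hv.conj.memLp.coeFn_toLp hv.conj.memLp_rhs.coeFn_toLp ae1 ae2,
        ← neg_eq_zero, ← integral_neg] at h0
      rw [← h0]
      refine integral_congr_ae (Eventually.of_forall fun s => ?_)
      simp only [Complex.conj_conj]
      ring
    refine ⟨c, d, ?_, ?_, ?_⟩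
    -- The remainder after removing the defect parts pairs to zero with everything; a test element
    -- with data `(0, 1)` then shows that its value at `t` vanishes.
    · obtain ⟨w, w', k, hw, w0, w1⟩ := exists_isTest_data hV t 0 1
      have := (hI.integral_cutoff pz hw).symm.trans (green (hw.isPair.mono (subset_univ I)))
      rw [w0, w1] at this
      have := (mul_eq_zero.1 this).resolve_left hσ
      linear_combination this
    · obtain ⟨w, w', k, hw, w0, w1⟩ := exists_isTest_data hV t 1 0
      have := (hI.integral_cutoff pz hw).symm.trans (green (hw.isPair.mono (subset_univ I)))
      rw [w0, w1] at this
      have := (mul_eq_zero.1 this).resolve_left hσ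
      linear_combination -this
    · rintro rfl rfl v v' h hv
      simpa using green hv
  intro u u' g v v' h hu hv
  obtain ⟨w, w', k, hw, w0, w1⟩ := exists_isTest_data hV t (u t) (u' t)
  have pw := hw.isPair.mono (subset_univ I)
  have hz := hu.sub pw
  obtain ⟨c, d, e1, e2, e3⟩ := dec hz
  obtain ⟨w₁, w₁', k₁, hw₁, w₁0, w₁1⟩ := exists_isTest_data hV t 1 0
  obtain ⟨w₂, w₂', k₂, hw₂, w₂0, w₂1⟩ := exists_isTest_data hV t 0 1
  obtain ⟨c₁, d₁, f1, f2, -⟩ := dec (hw₁.isPair.mono (subset_univ I))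
  obtain ⟨c₂, d₂, g1, g2, -⟩ := dec (hw₂.isPair.mono (subset_univ I))
  rw [w₁0] at f1; rw [w₁1] at f2; rw [w₂0] at g1; rw [w₂1] at g2
  rw [w0, sub_self] at e1
  rw [w1, sub_self] at e2
  -- The data `(1, 0)` and `(0, 1)` are combinations of the data of `a` and `b`, which are therefore
  -- independent. Zero data thus force `c = d = 0`.
  have hdet : (a t * b' t - a' t * b t) * (c₁ * d₂ - c₂ * d₁) = 1 := by
    have : (a t * b' t - a' t * b t) * (c₁ * d₂ - c₂ * d₁) =
        (c₁ * a t + d₁ * b t) * (c₂ * a' t + d₂ * b' t) -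
        (c₁ * a' t + d₁ * b' t) * (c₂ * a t + d₂ * b t) := by ring
    rw [this, ← f1, ← f2, ← g1, ← g2]
    ring
  have hc : c = 0 := by
    linear_combination (-c) * hdet - (c₁ * d₂ - c₂ * d₁) * (b' t * e1 - b t * e2)
  have hd : d = 0 := by
    linear_combination (-d) * hdet - (c₁ * d₂ - c₂ * d₁) * (a t * e2 - a' t * e1)
  have e4 := hI.integral_cutoff hv hw
  rw [w0, w1] at e4
  have i1 := (hu.memLp_rhs.mul_integrable hv.memLp).sub (hu.memLp.mul_integrable hv.memLp_rhs)
  have i2 := (hv.memLp_rhs.mul_integrable pw.memLp).sub (hv.memLp.mul_integrable pw.memLp_rhs)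
  have e5 := integral_add i1 i2
  simp only [Pi.sub_apply] at e5
  rw [e4] at e5
  have e6 : ∫ x in I, (g x * v x - u x * h x + (h x * w x - v x * k x)) = 0 := by
    rw [← e3 hc hd hv]
    refine integral_congr_ae (Eventually.of_forall fun x => ?_)
    simp only
    ring
  linear_combination e6 - e5

end

/-! ### Resolvents of symmetric operators with discrete spectrum -/

section


section Resolvent

open scoped ComplexInnerProductSpace

variable {E : Type*} [NormedAddCommGroup E] [InnerProductSpace ℂ E] {A : E →ₗ.[ℂ] E}

/-- `R` is the inverse of `A - lam`. -/
def IsResolvent (A : E →ₗ.[ℂ] E) (lam : ℂ) (R : E →L[ℂ] E) : Prop :=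
  (∀ g, ∃ h : R g ∈ A.domain, A ⟨R g, h⟩ - lam • R g = g) ∧
    ∀ f : A.domain, R (A f - lam • (f : E)) = f

open Classical in
/-- The resolvent of `A`, with the value `0` on the spectrum. -/
def resolventAt (A : E →ₗ.[ℂ] E) (lam : ℂ) : E →L[ℂ] E :=
  if h : lam ∈ resolventSet A then h.choose else 0

theorem isResolvent_resolventAt {lam : ℂ} (h : lam ∈ resolventSet A) :
    IsResolvent A lam (resolventAt A lam) := by
  rw [resolventAt, dif_pos h]
  exact h.choose_spec

/-- The first resolvent identity: apply `R (A - lam) = 1` to `S g`, using `A S g = g + mu S g`. -/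
theorem IsResolvent.sub_eq {lam mu : ℂ} {R S : E →L[ℂ] E} (hR : IsResolvent A lam R)
    (hS : IsResolvent A mu S) : S - R = (mu - lam) • (R * S) := by
  ext g
  obtain ⟨h, e⟩ := hS.1 g
  have := hR.2 ⟨S g, h⟩
  rw [eq_add_of_sub_eq e] at this
  simp only [map_sub, map_add, map_smul] at this
  simp only [sub_apply, smul_apply,
    mul_apply_eq_comp]
  nth_rewrite 1 [← this]
  module

theorem IsResolvent.unique {lam : ℂ} {R S : E →L[ℂ] E} (hR : IsResolvent A lam R)
    (hS : IsResolvent A lam S) : S = R := by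
  simpa [sub_eq_zero] using hR.sub_eq hS

theorem IsResolvent.mul_comm {lam mu : ℂ} {R S : E →L[ℂ] E} (hR : IsResolvent A lam R)
    (hS : IsResolvent A mu S) : R * S = S * R := by
  rcases eq_or_ne mu lam with rfl | hne
  · rw [hR.unique hS]
  · have h1 := hR.sub_eq hS
    have h2 := hS.sub_eq hR
    rw [← neg_sub, ← neg_sub mu lam, neg_smul, neg_inj, h1] at h2
    exact smul_right_injective _ (sub_ne_zero.2 hne) h2

/-- From the factorization `A - mu = (1 - (mu - lam) R) (A - lam)`. -/
theorem IsResolvent.of_isUnit {lam mu : ℂ} {R : E →L[ℂ] E} (hR : IsResolvent A lam R)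
    (h : IsUnit (1 - (mu - lam) • R)) :
    IsResolvent A mu (R * Ring.inverse (1 - (mu - lam) • R)) := by
  set B := Ring.inverse (1 - (mu - lam) • R)
  have h1 : (1 - (mu - lam) • R) * B = 1 := Ring.mul_inverse_cancel _ h
  have h2 : B * (1 - (mu - lam) • R) = 1 := Ring.inverse_mul_cancel _ h
  constructor
  · intro g
    obtain ⟨hd, e⟩ := hR.1 (B g)
    refine ⟨hd, ?_⟩
    have := congrArg (fun T : E →L[ℂ] E => T g) h1
    simp only [mul_apply_eq_comp, sub_apply,
      one_apply_eq_self, smul_apply] at this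
    change A ⟨R (B g), hd⟩ - mu • R (B g) = g
    rw [eq_add_of_sub_eq e]
    refine Eq.trans ?_ this
    module
  · intro f
    have hk := hR.2 f
    set k := A f - lam • (f : E) with hk0
    have e : A f - mu • (f : E) = (1 - (mu - lam) • R) k := by
      simp only [sub_apply, one_apply_eq_self,
        smul_apply]
      rw [hk, hk0]
      module
    have := congrArg (fun T : E →L[ℂ] E => T k) h2
    simp only [mul_apply_eq_comp, one_apply_eq_self] at this
    rw [e, mul_apply_eq_comp, this, hk]

theorem IsResolvent.isUnit {lam mu : ℂ} {R S : E →L[ℂ] E} (hR : IsResolvent A lam R)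
    (hS : IsResolvent A mu S) : IsUnit (1 - (mu - lam) • R) := by
  have h1 := hR.sub_eq hS
  have h2 := hR.mul_comm hS
  refine isUnit_iff_exists.2 ⟨1 + (mu - lam) • S, ?_, ?_⟩
  · simp only [sub_mul, mul_add, one_mul, mul_one, smul_mul_assoc, mul_smul_comm]
    rw [← h1]; module
  · simp only [add_mul, mul_sub, one_mul, mul_one, smul_mul_assoc, mul_smul_comm]
    rw [← h2, ← h1]; module

/-- `A` is symmetric. -/
def IsSymm (A : E →ₗ.[ℂ] E) : Prop := ∀ f g : A.domain, ⟪A f, (g : E)⟫ = ⟪(f : E), A g⟫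

theorem IsSymm.im_eq_zero (hA : IsSymm A) {lam : ℂ} (h : lam ∈ pointSpectrum A) : lam.im = 0 := by
  obtain ⟨f, ⟨hf, e⟩, h0⟩ := (Submodule.ne_bot_iff _).1 h
  have := hA ⟨f, hf⟩ ⟨f, hf⟩
  rw [e, inner_smul_left, inner_smul_right] at this
  have h1 := mul_right_cancel₀ (inner_self_ne_zero.2 h0) this
  exact Complex.conj_eq_iff_im.1 h1

theorem IsSymm.mem_resolventSet (hA : IsSymm A) (hd : HasDiscreteSpectrum A) {lam : ℂ}
    (h : lam.im ≠ 0) : lam ∈ resolventSet A := by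
  by_contra hc
  exact h (hA.im_eq_zero (hd lam hc).2.1)

variable [CompleteSpace E]

theorem isOpen_resolventSet : IsOpen (resolventSet A) := by
  rw [isOpen_iff_mem_nhds]
  intro z hz
  have hR := isResolvent_resolventAt hz
  have hc : ContinuousAt (fun mu : ℂ => 1 - (mu - z) • resolventAt A z) z := by fun_prop
  have : ∀ᶠ mu in 𝓝 z, IsUnit (1 - (mu - z) • resolventAt A z) :=
    hc.eventually (Units.isOpen.mem_nhds (by simp))
  filter_upwards [this] with mu hmu
  exact ⟨_, hR.of_isUnit hmu⟩

theorem differentiableOn_resolventAt : DifferentiableOn ℂ (resolventAt A) (resolventSet A) := by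
  intro z hz
  have hR := isResolvent_resolventAt hz
  have hd : DifferentiableAt ℂ
      (fun mu : ℂ => resolventAt A z * Ring.inverse (1 - (mu - z) • resolventAt A z)) z := by
    have h1 : DifferentiableAt ℂ Ring.inverse (1 - (z - z) • resolventAt A z) :=
      differentiableAt_inverse (𝕜 := ℂ) (x := 1 - (z - z) • resolventAt A z) (by simp)
    have h2 : DifferentiableAt ℂ (fun mu : ℂ => 1 - (mu - z) • resolventAt A z) z := by fun_prop
    exact (h1.comp z h2).const_mul _
  refine (hd.congr_of_eventuallyEq ?_).differentiableWithinAt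
  filter_upwards [isOpen_resolventSet.mem_nhds hz] with mu hmu
  have hS := isResolvent_resolventAt hmu
  exact (hR.of_isUnit (hR.isUnit hS)).unique hS

theorem analyticAt_inner_resolventAt {z : ℂ} (hz : z ∈ resolventSet A) (x y : E) :
    AnalyticAt ℂ (fun mu => ⟪x, resolventAt A mu y⟫) z := by
  have h1 : DifferentiableOn ℂ (fun mu => ⟪x, resolventAt A mu y⟫) (resolventSet A) := by
    intro w hw
    have h2 := differentiableOn_resolventAt w hw
    exact ((innerSL ℂ x).differentiableAt.comp_differentiableWithinAt w
      (h2.clm_apply (differentiableWithinAt_const y)))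
  exact h1.analyticAt (isOpen_resolventSet.mem_nhds hz)

/-- Symmetry identifies the adjoint of the resolvent at `lam` with the resolvent at the conjugate
point, and resolvents commute. -/
theorem IsSymm.isStarNormal (hA : IsSymm A) (hd : HasDiscreteSpectrum A) {lam : ℂ}
    (h : lam ∈ resolventSet A) : IsStarNormal (resolventAt A lam) := by
  have h' : starRingEnd ℂ lam ∈ resolventSet A := by
    rcases eq_or_ne lam.im 0 with h0 | h0
    · rwa [Complex.conj_eq_iff_im.2 h0]
    · exact hA.mem_resolventSet hd (by simpa using h0)
  have hR := isResolvent_resolventAt h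
  have hS := isResolvent_resolventAt h'
  have e : star (resolventAt A lam) = resolventAt A (starRingEnd ℂ lam) := by
    rw [ContinuousLinearMap.star_eq_adjoint, eq_comm, ContinuousLinearMap.eq_adjoint_iff]
    intro x y
    obtain ⟨h1, e1⟩ := hS.1 x
    obtain ⟨h2, e2⟩ := hR.1 y
    have := hA ⟨_, h1⟩ ⟨_, h2⟩
    rw [eq_add_of_sub_eq e1, eq_add_of_sub_eq e2, inner_add_left, inner_add_right, inner_smul_left,
      inner_smul_right, Complex.conj_conj] at this
    linear_combination -this
  exact ⟨by rw [e]; exact hS.mul_comm hR⟩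

/-- The norm of a normal operator is its spectral radius, and a nonzero spectral value `k` of the
resolvent comes from the point `lam + k⁻¹` of the spectrum of `A`. -/
theorem IsSymm.norm_resolventAt_le (hA : IsSymm A) (hd : HasDiscreteSpectrum A) {lam : ℂ} {δ : ℝ}
    (h : lam ∈ resolventSet A) (hδ : 0 < δ) (hdist : ∀ z ∈ spectrum A, δ ≤ ‖z - lam‖) :
    ‖resolventAt A lam‖ ≤ δ⁻¹ := by
  have := hA.isStarNormal hd h
  have hR := isResolvent_resolventAt h
  have h1 := IsStarNormal.spectralRadius_eq_nnnorm (resolventAt A lam)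
  have h2 : spectralRadius ℂ (resolventAt A lam) ≤ ENNReal.ofReal δ⁻¹ := by
    refine iSup₂_le fun k hk => ?_
    rw [← enorm_eq_nnnorm, ← ofReal_norm]
    refine ENNReal.ofReal_le_ofReal ?_
    rcases eq_or_ne k 0 with rfl | hk0
    · simpa using hδ.le
    · have hmem : lam + k⁻¹ ∈ spectrum A := by
        intro hc
        have hu := hR.isUnit (isResolvent_resolventAt hc)
        refine hk ?_
        rw [_root_.spectrum.mem_resolventSet_iff]
        have e : algebraMap ℂ (E →L[ℂ] E) k - resolventAt A lam =
            algebraMap ℂ (E →L[ℂ] E) k * (1 - (lam + k⁻¹ - lam) • resolventAt A lam) := by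
          rw [mul_sub, mul_one, add_sub_cancel_left, mul_smul_comm, Algebra.algebraMap_eq_smul_one,
            smul_mul_assoc, one_mul, smul_smul, inv_mul_cancel₀ hk0, one_smul]
        rw [e]
        exact ((IsUnit.mk0 k hk0).map (algebraMap ℂ (E →L[ℂ] E))).mul hu
      have := hdist _ hmem
      rw [add_sub_cancel_left, norm_inv] at this
      exact (le_inv_comm₀ hδ (norm_pos_iff.2 hk0)).1 this
  rw [h1, ← enorm_eq_nnnorm, ← ofReal_norm, ENNReal.ofReal_le_ofReal_iff (by positivity)] at h2
  exact h2

theorem HasDiscreteSpectrum.eventually_mem (hd : HasDiscreteSpectrum A) (z : ℂ) :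
    ∀ᶠ w in 𝓝[≠] z, w ∈ resolventSet A := by
  by_cases hz : z ∈ resolventSet A
  · exact nhdsWithin_le_nhds (isOpen_resolventSet.mem_nhds hz)
  · have := (hd z hz).1
    rw [accPt_iff_frequently_nhdsNE, not_frequently] at this
    filter_upwards [this] with w hw
    by_contra hc
    exact hw hc

/-- Close to `z` every spectral point is at distance at least `‖w - z‖` from `w`, so the resolvent
grows at most like `‖w - z‖⁻¹` and the singularity becomes removable after multiplication by a power
of `w - z`. -/
theorem IsSymm.meromorphicAt_inner_resolventAt (hA : IsSymm A) (hd : HasDiscreteSpectrum A)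
    (z : ℂ) (x y : E) : MeromorphicAt (fun mu => ⟪x, resolventAt A mu y⟫) z := by
  obtain ⟨r, hr, hball⟩ := Metric.mem_nhdsWithin_iff.1 (hd.eventually_mem z)
  have hb : ∀ w, w ≠ z → ‖w - z‖ < r / 2 →
      ‖(w - z) ^ 2 • ⟪x, resolventAt A w y⟫‖ ≤ ‖w - z‖ * (‖x‖ * ‖y‖) := by
    intro w hw hwr
    have hpos : 0 < ‖w - z‖ := norm_pos_iff.2 (sub_ne_zero.2 hw)
    have hwρ : w ∈ resolventSet A := hball ⟨by rw [mem_ball_iff_norm]; linarith, hw⟩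
    have h1 : ‖resolventAt A w‖ ≤ ‖w - z‖⁻¹ := by
      refine hA.norm_resolventAt_le hd hwρ hpos fun s hs => ?_
      rcases eq_or_ne s z with rfl | hsz
      · rw [norm_sub_rev]
      · have h2 : r ≤ ‖s - z‖ := by
          by_contra hc
          exact hs (hball ⟨by rw [mem_ball_iff_norm]; exact not_le.1 hc, hsz⟩)
        have h3 : ‖s - z‖ ≤ ‖s - w‖ + ‖w - z‖ := norm_sub_le_norm_sub_add_norm_sub _ _ _
        linarith
    have h2 : ‖⟪x, resolventAt A w y⟫‖ ≤ ‖x‖ * (‖w - z‖⁻¹ * ‖y‖) :=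
      (norm_inner_le_norm _ _).trans (mul_le_mul_of_nonneg_left
        ((resolventAt A w).le_of_opNorm_le h1 y) (norm_nonneg _))
    rw [norm_smul, norm_pow]
    calc _ ≤ ‖w - z‖ ^ 2 * (‖x‖ * (‖w - z‖⁻¹ * ‖y‖)) := by gcongr
      _ = _ := by field_simp
  -- The exponent `2` instead of `1` makes the product tend to `0`, which is also its value at `z`
  -- whatever the resolvent is there.
  refine ⟨2, Complex.analyticAt_of_differentiable_on_punctured_nhds_of_continuousAt ?_ ?_⟩
  · filter_upwards [hd.eventually_mem z] with w hw
    exact ((differentiableAt_id.sub_const z).pow 2).smul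
      (analyticAt_inner_resolventAt hw x y).differentiableAt
  · rw [ContinuousAt, sub_self, zero_pow two_ne_zero, zero_smul]
    have hlim : Tendsto (fun w : ℂ => ‖w - z‖ * (‖x‖ * ‖y‖)) (𝓝 z) (𝓝 0) := by
      have : ContinuousAt (fun w : ℂ => ‖w - z‖ * (‖x‖ * ‖y‖)) z := by fun_prop
      simpa [ContinuousAt] using this
    refine squeeze_zero_norm' ?_ hlim
    filter_upwards [Metric.ball_mem_nhds z (half_pos hr)] with w hw
    rcases eq_or_ne w z with rfl | hne
    · simp
    · exact hb w hne (by rwa [mem_ball_iff_norm] at hw)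

end Resolvent

end

/-! ### Symmetry of `H`, splitting of Cauchy data, square integrable solutions -/

section


variable {V : ℝ → ℝ} {I : Set ℝ} {u u' v v' g h : ℝ → ℂ} {t : ℝ} {σ : ℂ}

theorem isHalfLine_Ici (t : ℝ) : IsHalfLine (Ici t) t (-1) := Or.inl ⟨rfl, rfl⟩

theorem isHalfLine_Iic (t : ℝ) : IsHalfLine (Iic t) t 1 := Or.inr ⟨rfl, rfl⟩

theorem IsPair.integrable (hu : IsPair V I u u' g) (hv : IsPair V I v v' h) :
    IntegrableOn (fun x => g x * v x - u x * h x) I :=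
  (hu.memLp_rhs.mul_integrable hv.memLp).sub (hu.memLp.mul_integrable hv.memLp_rhs)

theorem GreenAt.Ici_of_le {s : ℝ} (hG : GreenAt V (Ici t) t (-1)) (hs : s ≤ t) :
    GreenAt V (Ici s) s (-1) := by
  intro u u' g v v' h hu hv
  have h1 := hG (hu.mono (Ici_subset_Ici.2 hs)) (hv.mono (Ici_subset_Ici.2 hs))
  have h2 := hu.integral_eq hv hs Icc_subset_Ici_self
  rw [integral_Icc_eq_integral_Ico] at h2
  have hi := hu.integrable hv
  rw [← Ico_union_Ici_eq_Ici hs, setIntegral_union (by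
    rw [Set.disjoint_left]; exact fun x hx hx' => absurd hx.2 (not_lt.2 hx')) measurableSet_Ici
    (hi.mono_set Ico_subset_Ici_self) (hi.mono_set (Ici_subset_Ici.2 hs)), h1, h2]
  ring

theorem GreenAt.Iic_of_le {s : ℝ} (hG : GreenAt V (Iic t) t 1) (hs : t ≤ s) :
    GreenAt V (Iic s) s 1 := by
  intro u u' g v v' h hu hv
  have h1 := hG (hu.mono (Iic_subset_Iic.2 hs)) (hv.mono (Iic_subset_Iic.2 hs))
  have h2 := hu.integral_eq hv hs Icc_subset_Iic_self
  rw [integral_Icc_eq_integral_Ioc] at h2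
  have hi := hu.integrable hv
  rw [← Iic_union_Ioc_eq_Iic hs, setIntegral_union (by
    rw [Set.disjoint_left]; exact fun x hx hx' => absurd hx'.1 (not_lt.2 hx)) measurableSet_Ioc
    (hi.mono_set (Iic_subset_Iic.2 hs)) (hi.mono_set Ioc_subset_Iic_self), h1, h2]
  ring

/-- Cutting the line at `t`, the two boundary terms differ only in sign and cancel. -/
theorem isSymm_maxOperator (hr : GreenAt V (Ici t) t (-1)) (hl : GreenAt V (Iic t) t 1) :
    IsSymm (maxOperator V univ) := by
  intro f₁ f₂
  have hmem : ∀ f : (maxOperator V univ).domain,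
      ((f : L2 univ), maxOperator V univ f) ∈ maxGraph V univ := fun f => by
    rw [← maxOperator_graph V ordConnected_univ]
    exact LinearPMap.mem_graph _ f
  obtain ⟨u, u', hu, pu⟩ := exists_isPair (hmem f₁)
  obtain ⟨v, v', hv, pv⟩ := exists_isPair (hmem f₂)
  rw [← sub_eq_zero, inner_sub_inner_eq hu (ae_eq_refl _) hv (ae_eq_refl _)]
  have hi := pu.conj.integrable pv
  have e1 := hr (pu.conj.mono (subset_univ _)) (pv.mono (subset_univ _))
  have e2 := hl (pu.conj.mono (subset_univ _)) (pv.mono (subset_univ _))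
  rw [integral_Ici_eq_integral_Ioi] at e1
  rw [setIntegral_univ, ← intervalIntegral.integral_Iic_add_Ioi (b := t)
    (hi.mono_set (subset_univ _)) (hi.mono_set (subset_univ _)), e1, e2]
  ring

section Functional

open scoped ComplexInnerProductSpace

theorem exists_inner_eq_setIntegral (hI : MeasurableSet I) (hv : MemLp v 2 (volume.restrict univ)) :
    ∃ x : L2 univ, ∀ (f : L2 univ) (u : ℝ → ℂ), f =ᵐ[volume.restrict univ] u →
      ⟪x, f⟫ = ∫ s in I, u s * v s := by
  have hc : MemLp (I.indicator fun s => starRingEnd ℂ (v s)) 2 (volume.restrict univ) :=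
    hv.starRingEnd.indicator hI
  refine ⟨hc.toLp _, fun f u hu => ?_⟩
  rw [L2.inner_def, ← integral_indicator hI, ← setIntegral_univ (μ := volume)]
  refine integral_congr_ae ?_
  filter_upwards [hc.coeFn_toLp, hu] with s h1 h2
  rw [h1, h2, RCLike.inner_apply]
  by_cases hs : s ∈ I <;> simp [hs]

/-- Point evaluations on the maximal domain are continuous for the graph norm. -/
theorem exists_eval (hV : LocallyIntegrable V volume) (t : ℝ) :
    ∃ x₀ y₀ x₁ y₁ : L2 univ, ∀ p ∈ maxGraph V univ, ∀ u u' : ℝ → ℂ,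
      p.1 =ᵐ[volume.restrict univ] u → IsPair V univ u u' p.2 →
      u t = ⟪x₀, p.1⟫ + ⟪y₀, p.2⟫ ∧ u' t = ⟪x₁, p.1⟫ + ⟪y₁, p.2⟫ := by
  obtain ⟨v, v', h, hv, v0, v1⟩ := exists_isTest_data hV t 0 1
  obtain ⟨w, w', k, hw, w0, w1⟩ := exists_isTest_data hV t 1 0
  obtain ⟨a, ha⟩ := exists_inner_eq_setIntegral (I := Ici t) measurableSet_Ici hv.isPair.memLp_rhs
  obtain ⟨b, hb⟩ := exists_inner_eq_setIntegral (I := Ici t) measurableSet_Ici hv.isPair.memLp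
  obtain ⟨c, hc⟩ := exists_inner_eq_setIntegral (I := Ici t) measurableSet_Ici hw.isPair.memLp_rhs
  obtain ⟨d, hd⟩ := exists_inner_eq_setIntegral (I := Ici t) measurableSet_Ici hw.isPair.memLp
  refine ⟨a, -b, -c, d, fun p _ u u' hu pu => ?_⟩
  rw [inner_neg_left, inner_neg_left, ha _ _ hu, hb _ _ (ae_eq_refl _), hc _ _ hu,
    hd _ _ (ae_eq_refl _)]
  have pu' := pu.mono (subset_univ (Ici t))
  have e1 := (isHalfLine_Ici t).integral_cutoff pu' hv
  have e2 := (isHalfLine_Ici t).integral_cutoff pu' hw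
  have hv' := hv.isPair.mono (subset_univ (Ici t))
  have hw' := hw.isPair.mono (subset_univ (Ici t))
  rw [integral_sub (pu'.memLp_rhs.mul_integrable hv'.memLp)
    (pu'.memLp.mul_integrable hv'.memLp_rhs), v0, v1] at e1
  rw [integral_sub (pu'.memLp_rhs.mul_integrable hw'.memLp)
    (pu'.memLp.mul_integrable hw'.memLp_rhs), w0, w1] at e2
  constructor
  · linear_combination e1
  · linear_combination -e2

/-- The splitting of the Cauchy data `(p, q)` at `t` into the data of square integrable solutions
on the two half-lines is analytic in the resolvent set and meromorphic in `ℂ`. -/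
theorem exists_split (hV : LocallyIntegrable V volume) (hs : IsSymm (maxOperator V univ))
    (hd : HasDiscreteSpectrum (maxOperator V univ)) (t : ℝ) (p q : ℂ) :
    ∃ P Q : ℂ → ℂ, (∀ z, MeromorphicAt P z) ∧ (∀ z, MeromorphicAt Q z) ∧
      ∀ lam ∈ resolventSet (maxOperator V univ), AnalyticAt ℂ P lam ∧ AnalyticAt ℂ Q lam ∧
      ∃ u u' w w' : ℝ → ℂ, IsPair V (Ici t) u u' (fun x => lam * u x) ∧
        IsPair V (Iic t) w w' (fun x => lam * w x) ∧ u t = P lam ∧ u' t = Q lam ∧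
        w t = p - P lam ∧ w' t = q - Q lam := by
  set R := resolventAt (maxOperator V univ)
  -- Take `u` to be the resolvent at `lam` applied to `k - lam f` restricted to the left of `t`.
  -- Then `u` solves the homogeneous equation on the right and `f - u` on the left, and their data
  -- at `t` add up to `(p, q)`. The function `L` writes the data of `u` through matrix elements of
  -- the resolvent.
  obtain ⟨f, f', k, hf, f0, f1⟩ := exists_isTest_data hV t p q
  obtain ⟨x₀, y₀, x₁, y₁, hev⟩ := exists_eval hV t
  have hm0 : MemLp ((Iic t).indicator f) 2 (volume.restrict univ) :=
    hf.isPair.memLp.indicator measurableSet_Iic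
  have hm1 : MemLp ((Iic t).indicator k) 2 (volume.restrict univ) :=
    hf.isPair.memLp_rhs.indicator measurableSet_Iic
  set k₀ : L2 univ := hm0.toLp _
  set k₁ : L2 univ := hm1.toLp _
  let L : L2 univ → L2 univ → ℂ → ℂ := fun x y lam =>
    (⟪x, R lam k₁⟫ - lam * ⟪x, R lam k₀⟫) + ((⟪y, k₁⟫ - lam * ⟪y, k₀⟫) +
      lam * (⟪y, R lam k₁⟫ - lam * ⟪y, R lam k₀⟫))
  have hL : ∀ x y lam, L x y lam = ⟪x, R lam (k₁ - lam • k₀)⟫ +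
      ⟪y, (k₁ - lam • k₀) + lam • R lam (k₁ - lam • k₀)⟫ := by
    intro x y lam
    simp only [L, map_sub, map_smul, inner_add_right, inner_sub_right, inner_smul_right]
  have hmer : ∀ x y z, MeromorphicAt (L x y) z := by
    intro x y z
    have hid : MeromorphicAt (fun lam : ℂ => lam) z := MeromorphicAt.id z
    have hR : ∀ x y, MeromorphicAt (fun lam => ⟪x, R lam y⟫) z := fun x y =>
      hs.meromorphicAt_inner_resolventAt hd z x y
    have hc : ∀ c : ℂ, MeromorphicAt (fun _ : ℂ => c) z := fun c => MeromorphicAt.const c z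
    exact ((hR _ _).fun_sub (hid.fun_mul (hR _ _))).fun_add
      (((hc _).fun_sub (hid.fun_mul (hc _))).fun_add
        (hid.fun_mul ((hR _ _).fun_sub (hid.fun_mul (hR _ _)))))
  have hana : ∀ x y, ∀ z ∈ resolventSet (maxOperator V univ), AnalyticAt ℂ (L x y) z := by
    intro x y z hz
    have hid : AnalyticAt ℂ (fun lam : ℂ => lam) z := analyticAt_id
    have hR : ∀ x y, AnalyticAt ℂ (fun lam => ⟪x, R lam y⟫) z := fun x y =>
      analyticAt_inner_resolventAt hz x y
    have hc : ∀ c : ℂ, AnalyticAt ℂ (fun _ : ℂ => c) z := fun c => analyticAt_const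
    exact ((hR _ _).fun_sub (hid.fun_mul (hR _ _))).fun_add
      (((hc _).fun_sub (hid.fun_mul (hc _))).fun_add
        (hid.fun_mul ((hR _ _).fun_sub (hid.fun_mul (hR _ _)))))
  refine ⟨L x₀ y₀, L x₁ y₁, hmer _ _, hmer _ _, fun lam hlam => ⟨hana _ _ _ hlam, hana _ _ _ hlam,
    ?_⟩⟩
  set k₂ : L2 univ := k₁ - lam • k₀
  obtain ⟨hdom, e⟩ := (isResolvent_resolventAt hlam).1 k₂
  have hgraph : (R lam k₂, k₂ + lam • R lam k₂) ∈ maxGraph V univ := by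
    rw [← maxOperator_graph V ordConnected_univ, ← eq_add_of_sub_eq e]
    exact LinearPMap.mem_graph _ ⟨R lam k₂, hdom⟩
  obtain ⟨u, u', hu, pu⟩ := exists_isPair hgraph
  obtain ⟨ev0, ev1⟩ := hev _ hgraph u u' hu pu
  have hrhs : ∀ᵐ x ∂((volume : Measure ℝ).restrict univ), (k₂ + lam • R lam k₂ : L2 univ) x =
      (Iic t).indicator k x - lam * (Iic t).indicator f x + lam * u x := by
    filter_upwards [Lp.coeFn_add k₂ (lam • R lam k₂), Lp.coeFn_sub k₁ (lam • k₀),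
      Lp.coeFn_smul lam k₀, Lp.coeFn_smul lam (R lam k₂), hm0.coeFn_toLp, hm1.coeFn_toLp, hu]
      with x h1 h2 h3 h4 h5 h6 h7
    rw [h1, Pi.add_apply, h2, Pi.sub_apply, h3, h4, Pi.smul_apply, Pi.smul_apply, h5, h6, h7,
      smul_eq_mul, smul_eq_mul]
  have pr := pu.mono (subset_univ (Ici t))
  have pl := (hf.isPair.sub pu).mono (subset_univ (Iic t))
  refine ⟨u, u', _, _, IsPair.homogeneous (pr.solves.congr_rhs ?_) pr.memLp,
    IsPair.homogeneous (pl.solves.congr_rhs ?_) pl.memLp, ?_, ?_, ?_, ?_⟩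
  · have hne : ∀ᵐ x : ℝ, x ≠ t := by simp [ae_iff, measure_singleton]
    filter_upwards [ae_restrict_of_ae_restrict_of_subset (subset_univ _) hrhs, ae_restrict_of_ae hne, ae_restrict_mem measurableSet_Ici]
      with x h1 h2 h3
    have : x ∉ Iic t := fun h => h2 (le_antisymm h h3)
    rw [h1, indicator_of_notMem this, indicator_of_notMem this]
    ring
  · filter_upwards [ae_restrict_of_ae_restrict_of_subset (subset_univ _) hrhs, ae_restrict_mem measurableSet_Iic] with x h1 h2
    rw [h1, indicator_of_mem h2, indicator_of_mem h2]
    ring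
  · rw [hL, ev0]
  · rw [hL, ev1]
  · rw [hL, ev0, f0]
  · rw [hL, ev1, f1]

end Functional

section Uniqueness

variable {lam : ℂ}

theorem IsHalfLine.ne_zero (hI : IsHalfLine I t σ) : σ ≠ 0 := by
  rcases hI with ⟨-, rfl⟩ | ⟨-, rfl⟩ <;> simp

theorem GreenAt.wronskian_eq_zero (hG : GreenAt V I t σ) (hI : IsHalfLine I t σ)
    (hu : IsPair V I u u' fun x => lam * u x) (hv : IsPair V I v v' fun x => lam * v x) :
    u t * v' t - u' t * v t = 0 := by
  have := hG hu hv
  have e : ∫ x in I, (lam * u x * v x - u x * (lam * v x)) = 0 := by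
    simp [mul_assoc, mul_left_comm]
  rw [e] at this
  exact (mul_eq_zero.1 this.symm).resolve_left hI.ne_zero

theorem GreenAt.integral_normSq (hG : GreenAt V I t σ)
    (hu : IsPair V I u u' fun x => lam * u x) :
    (lam - starRingEnd ℂ lam) * ∫ x in I, ((‖u x‖ ^ 2 : ℝ) : ℂ) =
      σ * (u t * starRingEnd ℂ (u' t) - u' t * starRingEnd ℂ (u t)) := by
  rw [← hG hu hu.conj, ← integral_const_mul]
  refine integral_congr_ae (Eventually.of_forall fun x => ?_)
  simp only [map_mul, Complex.ofReal_pow]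
  rw [← Complex.mul_conj']
  ring

/-- Green's identity for `u` and its conjugate gives `Im lam ‖u‖² = 0`, so `u = 0` almost
everywhere; pairing with a test element then yields `u' t = 0`. -/
theorem GreenAt.eq_zero_of_im_ne_zero (hV : LocallyIntegrable V volume) (hG : GreenAt V I t σ)
    (hI : IsHalfLine I t σ) (hlam : lam.im ≠ 0) (hu : IsPair V I u u' fun x => lam * u x)
    (h0 : u t = 0) : u' t = 0 := by
  have h1 := hG.integral_normSq hu
  rw [h0, map_zero, zero_mul, mul_zero, sub_zero, mul_zero, mul_eq_zero] at h1
  have h2 := h1.resolve_left (sub_ne_zero.2 fun h => hlam (Complex.conj_eq_iff_im.1 h.symm))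
  rw [integral_complex_ofReal, Complex.ofReal_eq_zero,
    integral_eq_zero_iff_of_nonneg (fun x => by positivity)
      ((memLp_two_iff_integrable_sq_norm hu.memLp.1).1 hu.memLp)] at h2
  obtain ⟨v, v', h, hv, v0, v1⟩ := exists_isTest_data hV t 1 0
  have e := hI.integral_cutoff hu hv
  have e0 : ∫ x in I, (lam * u x * v x - u x * h x) = 0 := by
    refine integral_eq_zero_of_ae ?_
    filter_upwards [h2] with x hx
    have : u x = 0 := by simpa using hx
    simp [this]
  rw [e0, v0, v1] at e
  have := (mul_eq_zero.1 e.symm).resolve_left hI.ne_zero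
  linear_combination -this

theorem exists_isPair_of_mem_pointSpectrum
    (h : lam ∈ pointSpectrum (maxOperator V univ)) :
    ∃ u u', IsPair V univ u u' (fun x => lam * u x) ∧ u ≠ 0 := by
  obtain ⟨f, hf, f0⟩ := (Submodule.ne_bot_iff _).1 h
  rw [mem_eigenspace_iff ordConnected_univ] at hf
  obtain ⟨u, u', hu, pu⟩ := exists_isPair hf
  refine ⟨u, u', IsPair.homogeneous (pu.solves.congr_rhs ?_) pu.memLp, fun h0 => f0 (Lp.ext ?_)⟩
  · filter_upwards [Lp.coeFn_smul lam f, hu] with x h1 h2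
    rw [h1, Pi.smul_apply, h2, smul_eq_mul]
  · filter_upwards [hu, Lp.coeFn_zero ℂ 2 (volume.restrict univ)] with x h1 h2
    rw [h1, h2, h0]

theorem eq_zero_of_data_eq_zero (hV : LocallyIntegrable V volume)
    (hu : Solves V univ u u' fun x => lam * u x) (h0 : u t = 0) (h1 : u' t = 0) : u = 0 := by
  have hz : Solves V univ (fun _ => 0) (fun _ => 0) fun x => lam * (0 : ℂ) := by
    simpa using Solves.zero V univ
  funext x
  exact (hu.eq_of_data hV ordConnected_univ hz (mem_univ t) h0 h1 x (mem_univ x)).1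

/-- In the limit point case every point outside of the essential spectrum admits nontrivial square
integrable solutions near both ends. -/
theorem exists_isPair_ne_zero (hV : LocallyIntegrable V volume)
    (hd : HasDiscreteSpectrum (maxOperator V univ)) (t : ℝ) (hr : GreenAt V (Ici t) t (-1))
    (hl : GreenAt V (Iic t) t 1) (lam : ℂ) :
    (∃ u u', IsPair V (Ici t) u u' (fun x => lam * u x) ∧ (u t ≠ 0 ∨ u' t ≠ 0)) ∧
    ∃ u u', IsPair V (Iic t) u u' (fun x => lam * u x) ∧ (u t ≠ 0 ∨ u' t ≠ 0) := by
  by_cases hlam : lam ∈ resolventSet (maxOperator V univ)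
  · have hs := isSymm_maxOperator hr hl
    obtain ⟨P, Q, -, -, hPQ⟩ := exists_split hV hs hd t 1 0
    obtain ⟨P₁, Q₁, -, -, hPQ₁⟩ := exists_split hV hs hd t 0 1
    obtain ⟨-, -, u, u', w, w', hu, hw, u0, u1, w0, w1⟩ := hPQ lam hlam
    obtain ⟨-, -, v, v', z, z', hv, hz, v0, v1, z0, z1⟩ := hPQ₁ lam hlam
    -- If one side had only the trivial solution, `(1, 0)` and `(0, 1)` would both be data of square
    -- integrable solutions on the other side, where Wronskians vanish.
    have e1 := hr.wronskian_eq_zero (isHalfLine_Ici t) hu hv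
    have e2 := hl.wronskian_eq_zero (isHalfLine_Iic t) hw hz
    rw [w0, w1, z0, z1] at e2
    rw [u0, u1, v0, v1] at e1
    constructor
    · by_contra! hc
      obtain ⟨a1, a2⟩ := hc u u' hu
      obtain ⟨b1, b2⟩ := hc v v' hv
      rw [← u0, ← u1, ← v0, ← v1, a1, a2, b1, b2] at e2
      norm_num at e2
    · by_contra! hc
      obtain ⟨a1, a2⟩ := hc w w' hw
      obtain ⟨b1, b2⟩ := hc z z' hz
      rw [w0] at a1; rw [w1] at a2; rw [z0] at b1; rw [z1] at b2
      rw [← sub_eq_zero.1 a1, ← sub_eq_zero.1 a2, ← sub_eq_zero.1 b1, ← sub_eq_zero.1 b2] at e1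
      norm_num at e1
  · obtain ⟨u, u', hu, h0⟩ := exists_isPair_of_mem_pointSpectrum (hd lam hlam).2.1
    have hne : u t ≠ 0 ∨ u' t ≠ 0 := by
      by_contra! hc
      exact h0 (eq_zero_of_data_eq_zero hV hu.solves hc.1 hc.2)
    exact ⟨⟨u, u', hu.mono (subset_univ _), hne⟩, ⟨u, u', hu.mono (subset_univ _), hne⟩⟩

end Uniqueness

end

/-! ### Weyl-Titchmarsh coefficients: boundary behaviour at real energies and existence -/

section


variable {V : ℝ → ℝ} {I : Set ℝ} {u u' : ℝ → ℂ} {t : ℝ} {σ : ℂ} {m : ℂ → ℂ}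

theorem norm_toLp_sq {μ : Measure ℝ} {f : ℝ → ℂ} (hf : MemLp f 2 μ) :
    ‖hf.toLp f‖ ^ 2 = ∫ x, ‖f x‖ ^ 2 ∂μ := by
  have h := inner_toLp hf hf
  rw [inner_self_eq_norm_sq_to_K] at h
  have e : ∫ x, starRingEnd ℂ (f x) * f x ∂μ = ∫ x, ((‖f x‖ ^ 2 : ℝ) : ℂ) ∂μ :=
    integral_congr_ae (Eventually.of_forall fun x => by
      simp only [Complex.ofReal_pow, Complex.conj_mul'])
  rw [e, integral_complex_ofReal] at h
  refine Complex.ofReal_injective ?_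
  rw [← h]
  push_cast
  rfl

theorem norm_integral_mul_sq_le {μ : Measure ℝ} {f g : ℝ → ℂ} (hf : MemLp f 2 μ)
    (hg : MemLp g 2 μ) :
    ‖∫ x, f x * g x ∂μ‖ ^ 2 ≤ (∫ x, ‖f x‖ ^ 2 ∂μ) * ∫ x, ‖g x‖ ^ 2 ∂μ := by
  have h := inner_toLp hf.starRingEnd hg
  simp only [Complex.conj_conj] at h
  have h1 := norm_toLp_sq hf.starRingEnd
  simp only [RCLike.norm_conj] at h1
  rw [← h, ← h1, ← norm_toLp_sq hg, ← mul_pow]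
  exact pow_le_pow_left₀ (norm_nonneg _) (norm_inner_le_norm _ _) 2

theorem IsHalfLine.conj_eq (hI : IsHalfLine I t σ) : starRingEnd ℂ σ = σ := by
  rcases hI with ⟨-, rfl⟩ | ⟨-, rfl⟩ <;> simp

theorem IsHalfLine.mul_self (hI : IsHalfLine I t σ) : σ * σ = 1 := by
  rcases hI with ⟨-, rfl⟩ | ⟨-, rfl⟩ <;> simp

theorem IsHalfLine.norm_eq (hI : IsHalfLine I t σ) : ‖σ‖ = 1 := by
  rcases hI with ⟨-, rfl⟩ | ⟨-, rfl⟩ <;> simp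

/-- Quantitative comparison of a square integrable solution at a real energy with the Weyl solution
at a nearby nonreal energy. -/
theorem GreenAt.norm_sq_le (hG : GreenAt V I t σ) (hI : IsHalfLine I t σ)
    (hm : IsWeylCoefficient V I t (-σ) m) {E : ℝ} (hu : IsPair V I u u' fun x => E * u x) :
    ∃ M : ℝ, ∀ η : ℝ, 0 < η → ‖u' t + σ * m (E + η * Complex.I) * u t‖ ^ 2 ≤
      M * (η * ‖m (E + η * Complex.I)‖) := by
  refine ⟨∫ x in I, ‖u x‖ ^ 2, fun η hη => ?_⟩
  set lam : ℂ := E + η * Complex.I with hlam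
  obtain ⟨c, c', s, s', hc, c0, c1, hs, s0, s1, h2⟩ := hm lam (by simpa [hlam] using hη.ne')
  have hφ : IsPair V I (fun x => c x + -σ * m lam * s x) (fun x => c' x + -σ * m lam * s' x)
      (fun x => lam * (c x + -σ * m lam * s x)) :=
    IsPair.homogeneous ((hc.add (hs.const_mul (-σ * m lam))).congr_rhs
      (Eventually.of_forall fun x => by ring)) h2
  have e1 := hG.integral_normSq hφ
  have e2 := hG hφ hu
  rw [integral_complex_ofReal] at e1
  set N : ℝ := ∫ x in I, ‖c x + -σ * m lam * s x‖ ^ 2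
  have e3 : ∫ x in I, (lam * (c x + -σ * m lam * s x) * u x -
      (c x + -σ * m lam * s x) * (E * u x)) =
      η * Complex.I * ∫ x in I, (c x + -σ * m lam * s x) * u x := by
    rw [← integral_const_mul]
    refine integral_congr_ae (Eventually.of_forall fun x => ?_)
    simp only [hlam]
    ring
  rw [e3] at e2
  simp only [c0, c1, s0, s1, map_add, map_mul, map_neg, map_one, map_zero, hI.conj_eq] at e1 e2
  -- Weyl's identity for the solution `φ` with data `(1, -σ m)`: Green's identity for `φ` and its
  -- conjugate.
  have hN : η * N = (m lam).im := by
    have h1 : lam - starRingEnd ℂ lam = 2 * η * Complex.I := by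
      simp only [hlam, map_add, map_mul, Complex.conj_ofReal, Complex.conj_I]; ring
    have h2 : m lam - starRingEnd ℂ (m lam) = 2 * (m lam).im * Complex.I := by
      rw [Complex.sub_conj]; push_cast; ring
    have h3 : (2 * Complex.I) * ((η * N : ℝ) : ℂ) = (2 * Complex.I) * ((m lam).im : ℂ) := by
      push_cast
      rw [h1] at e1
      linear_combination e1 + h2 + (m lam - starRingEnd ℂ (m lam)) * hI.mul_self
    exact_mod_cast mul_left_cancel₀ (by simp) h3
  -- Green's identity for `φ` and `u`, whose energies differ by `iη`; the defect in the boundary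
  -- condition is `η` times a pairing that Cauchy-Schwarz bounds.
  have hnorm : ‖u' t + σ * m lam * u t‖ = η * ‖∫ x in I, (c x + -σ * m lam * s x) * u x‖ := by
    have := congrArg norm e2
    rw [norm_mul, norm_mul, norm_mul, Complex.norm_I, Complex.norm_real, hI.norm_eq, mul_one,
      one_mul, Real.norm_of_nonneg hη.le] at this
    rw [this]
    congr 1
    ring
  have hcs := norm_integral_mul_sq_le hφ.memLp hu.memLp
  have hM : 0 ≤ ∫ x in I, ‖u x‖ ^ 2 := integral_nonneg fun x => by positivity
  calc _ = η ^ 2 * ‖∫ x in I, (c x + -σ * m lam * s x) * u x‖ ^ 2 := by rw [hnorm]; ring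
    _ ≤ η ^ 2 * (N * ∫ x in I, ‖u x‖ ^ 2) := by gcongr
    _ = (∫ x in I, ‖u x‖ ^ 2) * (η * (m lam).im) := by rw [← hN]; ring
    _ ≤ _ := by
        gcongr
        exact (le_abs_self _).trans (Complex.abs_im_le_norm _)

theorem tendsto_add_mul_I (E : ℝ) :
    Tendsto (fun η : ℝ => (E : ℂ) + η * Complex.I) (𝓝[>] 0) (𝓝[≠] (E : ℂ)) := by
  refine tendsto_nhdsWithin_iff.2 ⟨?_, ?_⟩
  · have : ContinuousAt (fun η : ℝ => (E : ℂ) + η * Complex.I) 0 := by fun_prop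
    have h := this.tendsto
    simp only [Complex.ofReal_zero, zero_mul, add_zero] at h
    exact h.mono_left nhdsWithin_le_nhds
  · filter_upwards [self_mem_nhdsWithin] with η hη h
    have : (η : ℂ) * Complex.I = 0 := by simpa using h
    simp at this
    exact (mem_Ioi.1 hη).ne' this

/-- Square integrable solutions at a real energy satisfy the boundary condition given by the
meromorphic continuation of the Weyl-Titchmarsh coefficient. -/
theorem GreenAt.boundary_condition (hG : GreenAt V I t σ) (hI : IsHalfLine I t σ)
    (hm : IsMeromorphicWeylCoefficient V I t (-σ) m) {E : ℝ}
    (hu : IsPair V I u u' fun x => E * u x) :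
    (HasPole m E → u t = 0) ∧ (¬ HasPole m E → u' t + σ * m E * u t = 0) := by
  obtain ⟨M, hM⟩ := hG.norm_sq_le hI hm.weyl hu
  have hlim := tendsto_add_mul_I E
  have hη : Tendsto (fun η : ℝ => η) (𝓝[>] 0) (𝓝 0) := nhdsWithin_le_nhds
  constructor
  · intro hp
    -- At a pole the bound is divided by `|m|²`: the left side tends to `|u t|²` and the right side,
    -- `M η / |m|`, to `0`. The order of the pole plays no role.
    have h1 : Tendsto (fun η : ℝ => m (E + η * Complex.I)) (𝓝[>] 0) (Bornology.cobounded ℂ) :=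
      (tendsto_cobounded_of_meromorphicOrderAt_neg hp).comp hlim
    have h2 := tendsto_inv₀_cobounded.comp h1
    have h3 : Tendsto (fun η : ℝ => ‖u' t * (m (E + η * Complex.I))⁻¹ + σ * u t‖ ^ 2) (𝓝[>] 0)
        (𝓝 (‖u' t * 0 + σ * u t‖ ^ 2)) :=
      (((h2.const_mul (u' t)).add_const _).norm).pow 2
    have h4 : Tendsto (fun η : ℝ => M * (η * ‖(m (E + η * Complex.I))⁻¹‖)) (𝓝[>] 0)
        (𝓝 (M * (0 * ‖(0 : ℂ)‖))) := (hη.mul h2.norm).const_mul M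
    have h5 := le_of_tendsto_of_tendsto h3 h4 (by
      have hne : ∀ᶠ η : ℝ in 𝓝[>] 0, m (E + η * Complex.I) ≠ 0 := by
        have := h1.eventually (Bornology.eventually_ne_cobounded (0 : ℂ))
        exact this
      filter_upwards [self_mem_nhdsWithin, hne] with η hη hne
      have h6 := hM η hη
      set z := m (E + η * Complex.I)
      have e : u' t * z⁻¹ + σ * u t = (u' t + σ * z * u t) * z⁻¹ := by field_simp
      have hz : 0 < ‖z‖ := norm_pos_iff.2 hne
      rw [e, norm_mul, mul_pow, norm_inv]
      calc _ ≤ M * (η * ‖z‖) * ‖z‖⁻¹ ^ 2 := by gcongr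
        _ = _ := by field_simp)
    simp only [mul_zero, zero_add, norm_zero, norm_mul, hI.norm_eq, one_mul] at h5
    exact norm_eq_zero.1 (pow_eq_zero_iff two_ne_zero |>.1 (le_antisymm h5 (by positivity)))
  · intro hp
    -- Normal form is what makes the value `m E` equal to the limit from nonreal energies.
    have ha : AnalyticAt ℂ m E :=
      (hm.meromorphic (mem_univ _)).meromorphicOrderAt_nonneg_iff_analyticAt.1 (not_lt.1 hp)
    have h1 : Tendsto (fun η : ℝ => m (E + η * Complex.I)) (𝓝[>] 0) (𝓝 (m E)) :=
      ha.continuousAt.tendsto.comp (hlim.mono_right nhdsWithin_le_nhds)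
    have h3 : Tendsto (fun η : ℝ => ‖u' t + σ * m (E + η * Complex.I) * u t‖ ^ 2) (𝓝[>] 0)
        (𝓝 (‖u' t + σ * m E * u t‖ ^ 2)) :=
      ((((h1.const_mul σ).mul_const _).const_add _).norm).pow 2
    have h4 : Tendsto (fun η : ℝ => M * (η * ‖m (E + η * Complex.I)‖)) (𝓝[>] 0)
        (𝓝 (M * (0 * ‖m E‖))) := (hη.mul h1.norm).const_mul M
    have h5 := le_of_tendsto_of_tendsto h3 h4 (by
      filter_upwards [self_mem_nhdsWithin] with η hη using hM η hη)
    rw [zero_mul, mul_zero] at h5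
    exact norm_eq_zero.1 (pow_eq_zero_iff two_ne_zero |>.1 (le_antisymm h5 (by positivity)))

/-- The coefficient is `N / D`: dividing the square integrable solution by its value `D` at `t`
gives data `(1, -σ N / D)`, so by uniqueness it is the Weyl solution. Passing to normal form changes
nothing at nonreal points, where the quotient is analytic. -/
theorem exists_meromorphicWeylCoefficient (hV : LocallyIntegrable V volume)
    (hI : IsHalfLine I t σ) {N D : ℂ → ℂ} (hN : ∀ z, MeromorphicAt N z)
    (hD : ∀ z, MeromorphicAt D z) (h : ∀ lam : ℂ, lam.im ≠ 0 → AnalyticAt ℂ N lam ∧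
      AnalyticAt ℂ D lam ∧ D lam ≠ 0 ∧ ∃ u u', IsPair V I u u' (fun x => lam * u x) ∧
        u t = D lam ∧ u' t = -σ * N lam) :
    ∃ m, IsMeromorphicWeylCoefficient V I t (-σ) m := by
  have hmer : MeromorphicOn (fun z => N z / D z) univ := fun z _ => (hN z).fun_div (hD z)
  refine ⟨toMeromorphicNFOn (fun z => N z / D z) univ, meromorphicNFOn_toMeromorphicNFOn _ _,
    fun lam hlam => ?_⟩
  obtain ⟨hNa, hDa, hD0, u, u', hu, u0, u1⟩ := h lam hlam
  have hval : toMeromorphicNFOn (fun z => N z / D z) univ lam = N lam / D lam := by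
    rw [toMeromorphicNFOn_eq_toMeromorphicNFAt hmer (mem_univ lam),
      toMeromorphicNFAt_eq_self.2 (hNa.fun_div hDa hD0).meromorphicNFAt]
  obtain ⟨c, c', hc, c0, c1⟩ := exists_solves hV lam locallyIntegrable_zero t 1 0
  obtain ⟨s, s', hs, s0, s1⟩ := exists_solves hV lam locallyIntegrable_zero t 0 1
  simp only [add_zero] at hc hs
  replace hc := hc.mono (subset_univ I)
  replace hs := hs.mono (subset_univ I)
  refine ⟨c, c', s, s', hc, c0, c1, hs, s0, s1, ?_⟩
  rw [hval]
  have h1 : Solves V I (fun x => c x + -σ * (N lam / D lam) * s x)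
      (fun x => c' x + -σ * (N lam / D lam) * s' x)
      (fun x => lam * (c x + -σ * (N lam / D lam) * s x)) :=
    (hc.add (hs.const_mul _)).congr_rhs (Eventually.of_forall fun x => by ring)
  have h2 : Solves V I (fun x => (D lam)⁻¹ * u x) (fun x => (D lam)⁻¹ * u' x)
      (fun x => lam * ((D lam)⁻¹ * u x)) :=
    (hu.solves.const_mul _).congr_rhs (Eventually.of_forall fun x => by ring)
  have h3 := h1.eq_of_data hV hI.ordConnected h2 hI.mem (by
    rw [c0, s0, u0, inv_mul_cancel₀ hD0]; ring) (by
    rw [c1, s1, u1]; field_simp; ring)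
  refine (hu.memLp.const_mul (D lam)⁻¹).ae_eq ?_
  filter_upwards [ae_restrict_mem hI.measurableSet] with x hx
  rw [(h3 x hx).1]

/-- Splitting the data `(0, 1)` gives values `P` and `-P` at `t`, so one function is the denominator
on both sides. It has no nonreal zero: otherwise both solutions would have zero derivative at `t`,
yet the derivatives sum to `1`. -/
theorem exists_meromorphicWeylCoefficients (hV : LocallyIntegrable V volume)
    (hd : HasDiscreteSpectrum (maxOperator V univ)) (t : ℝ) (hr : GreenAt V (Ici t) t (-1))
    (hl : GreenAt V (Iic t) t 1) :
    (∃ m, IsMeromorphicWeylCoefficient V (Iic t) t (-1) m) ∧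
    ∃ m, IsMeromorphicWeylCoefficient V (Ici t) t 1 m := by
  have hs := isSymm_maxOperator hr hl
  obtain ⟨P, Q, hP, hQ, hPQ⟩ := exists_split hV hs hd t 0 1
  have key : ∀ lam : ℂ, lam.im ≠ 0 → AnalyticAt ℂ P lam ∧ AnalyticAt ℂ Q lam ∧ P lam ≠ 0 ∧
      ∃ u u' w w' : ℝ → ℂ, IsPair V (Ici t) u u' (fun x => lam * u x) ∧
        IsPair V (Iic t) w w' (fun x => lam * w x) ∧ u t = P lam ∧ u' t = Q lam ∧
        w t = 0 - P lam ∧ w' t = 1 - Q lam := by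
    intro lam hlam
    obtain ⟨h1, h2, u, u', w, w', hu, hw, u0, u1, w0, w1⟩ := hPQ lam (hs.mem_resolventSet hd hlam)
    refine ⟨h1, h2, fun h0 => ?_, u, u', w, w', hu, hw, u0, u1, w0, w1⟩
    have e1 := hr.eq_zero_of_im_ne_zero hV (isHalfLine_Ici t) hlam hu (by rw [u0, h0])
    have e2 := hl.eq_zero_of_im_ne_zero hV (isHalfLine_Iic t) hlam hw (by rw [w0, h0, sub_zero])
    rw [u1] at e1
    rw [w1, e1] at e2
    norm_num at e2
  constructor
  · refine exists_meromorphicWeylCoefficient hV (isHalfLine_Iic t) (N := fun z => Q z - 1)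
      (D := fun z => -P z) (fun z => (hQ z).fun_sub (MeromorphicAt.const 1 z))
      (fun z => (hP z).fun_neg) fun lam hlam => ?_
    obtain ⟨h1, h2, h3, u, u', w, w', -, hw, -, -, w0, w1⟩ := key lam hlam
    exact ⟨h2.fun_sub analyticAt_const, h1.fun_neg, neg_ne_zero.2 h3, w, w', hw,
      by rw [w0]; ring, by rw [w1]; ring⟩
  · have := exists_meromorphicWeylCoefficient hV (isHalfLine_Ici t) hQ hP fun lam hlam => by
      obtain ⟨h1, h2, h3, u, u', w, w', hu, -, u0, u1, -, -⟩ := key lam hlam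
      exact ⟨h2, h1, h3, u, u', hu, u0, by rw [u1]; ring⟩
    simpa using this

end

/-! ### Matching the interval problem with the whole-line operator -/

section


variable {V : ℝ → ℝ} {I : Set ℝ} {u u' v v' : ℝ → ℂ} {t : ℝ} {σ : ℂ}

theorem mem_pointSpectrum_of_isPair {lam : ℂ} (hu : IsPair V univ u u' fun x => lam * u x)
    (h0 : u ≠ 0) : lam ∈ pointSpectrum (maxOperator V univ) := by
  refine (Submodule.ne_bot_iff _).2 ⟨hu.memLp.toLp u, ?_, fun h => h0 ?_⟩
  · rw [mem_eigenspace_iff ordConnected_univ]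
    refine hu.mem_maxGraph_of_ae hu.memLp.coeFn_toLp ?_
    filter_upwards [Lp.coeFn_smul lam (hu.memLp.toLp u), hu.memLp.coeFn_toLp] with x h1 h2
    rw [h1, Pi.smul_apply, h2, smul_eq_mul]
  · have h1 : u =ᵐ[volume] 0 := by
      rw [← Measure.restrict_univ (μ := (volume : Measure ℝ))]
      have := hu.memLp.coeFn_toLp
      rw [h] at this
      exact this.symm.trans (Lp.coeFn_zero _ _ _)
    exact (hu.solves.continuous.ae_eq_iff_eq volume continuous_zero).1 h1

/-- A solution whose Cauchy data at the endpoint are proportional to those of a nontrivial square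
integrable solution is square integrable. -/
theorem Solves.memLp_of_wronskian_eq_zero (hV : LocallyIntegrable V volume)
    (hI : IsHalfLine I t σ) {lam : ℂ} (hu : Solves V I u u' fun x => lam * u x)
    (hv : IsPair V I v v' fun x => lam * v x) (hne : v t ≠ 0 ∨ v' t ≠ 0)
    (hw : u t * v' t - u' t * v t = 0) : MemLp u 2 (volume.restrict I) := by
  obtain ⟨κ, e0, e1⟩ : ∃ κ : ℂ, u t = κ * v t ∧ u' t = κ * v' t := by
    rcases hne with h | h
    · exact ⟨u t / v t, by field_simp, by field_simp; linear_combination -hw⟩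
    · exact ⟨u' t / v' t, by field_simp; linear_combination hw, by field_simp⟩
  have h2 : Solves V I (fun x => κ * v x) (fun x => κ * v' x) fun x => lam * (κ * v x) :=
    (hv.solves.const_mul κ).congr_rhs (Eventually.of_forall fun x => by ring)
  have h3 := hu.eq_of_data hV hI.ordConnected h2 hI.mem e0 e1
  refine (hv.memLp.const_mul κ).ae_eq ?_
  filter_upwards [ae_restrict_mem hI.measurableSet] with x hx
  rw [(h3 x hx).1]

theorem memLp_univ_of_half_lines {a b : ℝ} (hc : Continuous u)
    (hl : MemLp u 2 (volume.restrict (Iic a))) (hr : MemLp u 2 (volume.restrict (Ici b))) :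
    MemLp u 2 (volume.restrict univ) := by
  have hm := hc.memLp_Icc a b
  have e : (univ : Set ℝ) = Iic a ∪ Icc a b ∪ Ici b := by
    ext x
    simp only [mem_univ, mem_union, mem_Iic, mem_Icc, mem_Ici, true_iff]
    rcases le_total x a with h | h
    · exact Or.inl (Or.inl h)
    · rcases le_total x b with h' | h'
      · exact Or.inl (Or.inr ⟨h, h'⟩)
      · exact Or.inr h'
  rw [memLp_two_iff_integrable_sq_norm hc.aestronglyMeasurable] at hl hr hm ⊢
  rw [e]
  exact (IntegrableOn.union hl hm).union hr

/-- The extension `f` of `φ` to the line satisfies at each endpoint the same linear condition as a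
nontrivial square integrable solution outside. Their Wronskian vanishes there, so `f` is square
integrable on both half-lines. -/
theorem mem_pointSpectrum_of_isEigenvalue (hV : LocallyIntegrable V volume) {a b : ℝ}
    (hab : a < b) (hd : HasDiscreteSpectrum (maxOperator V univ))
    (hGr : GreenAt V (Ici b) b (-1)) (hGl : GreenAt V (Iic a) a 1) {m₁ m₂ : ℂ → ℂ}
    (hm₁ : IsMeromorphicWeylCoefficient V (Iic a) a (-1) m₁)
    (hm₂ : IsMeromorphicWeylCoefficient V (Ici b) b (- -1) m₂) {E : ℝ}
    (hE : IsEigenvalue V a b m₁ m₂ E) : (E : ℂ) ∈ pointSpectrum (maxOperator V univ) := by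
  obtain ⟨φ, φ', -, ⟨x₀, hx₀, hne⟩, hφ, p1, n1, p2, n2⟩ := hE
  obtain ⟨f, f', hf, f0, f1⟩ := exists_solves hV E locallyIntegrable_zero a (φ a) (φ' a)
  simp only [add_zero] at hf
  have heq := (hf.mono (subset_univ (Icc a b))).eq_of_data hV ordConnected_Icc hφ
    (left_mem_Icc.2 hab.le) f0 f1
  obtain ⟨fb, fb'⟩ := heq b (right_mem_Icc.2 hab.le)
  obtain ⟨⟨v, v', hv, hv0⟩, -⟩ := exists_isPair_ne_zero hV hd b hGr (hGl.Iic_of_le hab.le) E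
  obtain ⟨-, w, w', hw, hw0⟩ := exists_isPair_ne_zero hV hd a (hGr.Ici_of_le hab.le) hGl E
  obtain ⟨vp, vn⟩ := hGr.boundary_condition (isHalfLine_Ici b) hm₂ hv
  obtain ⟨wp, wn⟩ := hGl.boundary_condition (isHalfLine_Iic a) hm₁ hw
  have hr : MemLp f 2 (volume.restrict (Ici b)) := by
    refine (hf.mono (subset_univ _)).memLp_of_wronskian_eq_zero hV (isHalfLine_Ici b) hv hv0 ?_
    rw [fb, fb']
    by_cases hp : HasPole m₂ E
    · rw [p2 hp, vp hp]; ring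
    · linear_combination φ b * vn hp - v b * n2 hp
  have hl : MemLp f 2 (volume.restrict (Iic a)) := by
    refine (hf.mono (subset_univ _)).memLp_of_wronskian_eq_zero hV (isHalfLine_Iic a) hw hw0 ?_
    rw [f0, f1]
    by_cases hp : HasPole m₁ E
    · rw [p1 hp, wp hp]; ring
    · linear_combination φ a * wn hp - w a * n1 hp
  refine mem_pointSpectrum_of_isPair
    (IsPair.homogeneous hf (memLp_univ_of_half_lines hf.continuous hl hr)) fun h => hne ?_
  rw [← (heq x₀ hx₀).1, h, Pi.zero_apply]

theorem isEigenvalue_of_isPair (hV : LocallyIntegrable V volume) {a b : ℝ}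
    (hab : a < b) (hGr : GreenAt V (Ici b) b (-1)) (hGl : GreenAt V (Iic a) a 1) {m₁ m₂ : ℂ → ℂ}
    (hm₁ : IsMeromorphicWeylCoefficient V (Iic a) a (-1) m₁)
    (hm₂ : IsMeromorphicWeylCoefficient V (Ici b) b (- -1) m₂) {E : ℝ}
    (hu : IsPair V univ u u' fun x => E * u x) (h0 : u ≠ 0) : IsEigenvalue V a b m₁ m₂ E := by
  obtain ⟨vp, vn⟩ := hGr.boundary_condition (isHalfLine_Ici b) hm₂ (hu.mono (subset_univ _))
  obtain ⟨wp, wn⟩ := hGl.boundary_condition (isHalfLine_Iic a) hm₁ (hu.mono (subset_univ _))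
  refine ⟨u, u', hu.solves.continuous.memLp_Icc a b, ?_, hu.solves.mono (subset_univ _), wp,
    fun h => ?_, vp, fun h => ?_⟩
  -- An eigenfunction vanishing on the interval would have zero Cauchy data at an interior point.
  · by_contra! hc
    obtain ⟨x, hx⟩ := nonempty_Ioo.2 hab
    refine h0 (eq_zero_of_data_eq_zero hV hu.solves (hc x (Ioo_subset_Icc_self hx)) ?_)
    have h1 : HasDerivAt u (u' x) x := by simpa using hu.solves.deriv x (mem_univ x)
    refine h1.unique ((hasDerivAt_const x (0 : ℂ)).congr_of_eventuallyEq ?_)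
    filter_upwards [Ioo_mem_nhds hx.1 hx.2] with y hy using hc y (Ioo_subset_Icc_self hy)
  · linear_combination wn h
  · linear_combination vn h

end

end Schrodinger

end


/-- Under the limit point hypothesis at `±∞` and discreteness of the spectrum of the whole-line
operator `H`, the Weyl-Titchmarsh coefficients extend meromorphically to `ℂ`, and the eigenvalues
of the interval problem with the corresponding boundary conditions are exactly those of `H`. -/
theorem mainTheorem4 (V : ℝ → ℝ) (hV : MeasureTheory.LocallyIntegrable V MeasureTheory.volume)
    (a b : ℝ) (hab : a < b)
    (hminus : Schrodinger.LimitPoint V (Set.Iic a)) (hplus : Schrodinger.LimitPoint V (Set.Ici b))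
    (hdisc : Schrodinger.HasDiscreteSpectrum (Schrodinger.maxOperator V Set.univ)) :
    (∃ m₁, Schrodinger.IsMeromorphicWeylCoefficient V (Set.Iic a) a (-1) m₁) ∧
    (∃ m₂, Schrodinger.IsMeromorphicWeylCoefficient V (Set.Ici b) b 1 m₂) ∧
    ∀ m₁ m₂ : ℂ → ℂ,
      Schrodinger.IsMeromorphicWeylCoefficient V (Set.Iic a) a (-1) m₁ →
      Schrodinger.IsMeromorphicWeylCoefficient V (Set.Ici b) b 1 m₂ →
      ((fun E : ℝ => (E : ℂ)) '' {E : ℝ | Schrodinger.IsEigenvalue V a b m₁ m₂ E}) =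
        Schrodinger.pointSpectrum (Schrodinger.maxOperator V Set.univ) := by
  have hGr := (Schrodinger.isHalfLine_Ici b).greenAt hV hplus
  have hGl := (Schrodinger.isHalfLine_Iic a).greenAt hV hminus
  -- Each coefficient is built by splitting at its own endpoint, so the Green identity of the
  -- opposite half-line is first moved to that endpoint.
  refine ⟨(Schrodinger.exists_meromorphicWeylCoefficients hV hdisc a
    (hGr.Ici_of_le hab.le) hGl).1, (Schrodinger.exists_meromorphicWeylCoefficients hV hdisc b hGr
    (hGl.Iic_of_le hab.le)).2, fun m₁ m₂ hm₁ hm₂ => ?_⟩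
  rw [← neg_neg (1 : ℂ)] at hm₂
  ext z
  constructor
  · rintro ⟨E, hE, rfl⟩
    exact Schrodinger.mem_pointSpectrum_of_isEigenvalue hV hab hdisc hGr hGl hm₁ hm₂ hE
  · intro hz
    -- The eigenvalues of `H` are real, so none is missed by real energies `E`.
    have him := (Schrodinger.isSymm_maxOperator hGr (hGl.Iic_of_le hab.le)).im_eq_zero hz
    have e : ((z.re : ℝ) : ℂ) = z := Complex.ext rfl (by simp [him])
    rw [← e] at hz ⊢
    obtain ⟨u, u', hu, h0⟩ := Schrodinger.exists_isPair_of_mem_pointSpectrum hz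
    exact ⟨z.re, Schrodinger.isEigenvalue_of_isPair hV hab hGr hGl hm₁ hm₂ hu h0, rfl⟩
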